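/- Let $\Omega=(l_1,l_2)\times(l_3,l_4)$, let $\psi$ be a smooth function with interface $\Gamma_I=\{q\in\Omega:\psi(q)=0\}$, and let $p=(x_0,l_4)$ with $l_1<x_0<l_2$ be a point of the side $\Gamma_4=(l_1,l_2)\times\{l_4\}$ with $\psi(p)\neq 0$. Consider the problem $$-\nabla\cdot(a\nabla u)=f \ \text{ in } \Omega\setminus\Gamma_I,\qquad \frac{\partial u}{\partial \vec n}+\beta(x)u=g_4\ \text{ on }\Gamma_4,$$ with $a>0$. "Piecewise $C^k$" means $C^k$ on each side of $\{\psi=0\}$, up to the outer boundary of the rectangle. A superscript $(m,n)$ denotes the derivative $\partial_x^m\partial_y^n$ at $p$, and $\beta^{(n)},g_4^{(n)}$ are the derivatives at $x_0$. Let $\Lambda_N=\{(m,n)\in\mathbb N_0^2: m+n\le N\}$, $\Lambda_N^{H,1}=\{(m,n)\in\Lambda_N:n\le 1\}$ and $\Lambda_N^{H,2}=\Lambda_N\setminus\Lambda_N^{H,1}$. The differential equation and its derivatives at $p$ express every $u^{(m',n')}$ with $n'\ge 2$ as a linear combination of the $u^{(m,n)}$ with $n\le 1$ and of the $f^{(m,n)}$;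 let $A^{u}_{m',n',m,n}$ and $A^{f}_{m',n',m,n}$ be the coefficients in it. Put $$G_{m,n}(x,y)=\sum_{\ell=0}^{\lfloor m/2\rfloor}\frac{(-1)^\ell y^{n+2\ell}x^{m-2\ell}}{(n+2\ell)!(m-2\ell)!}+\sum_{(m',n')\in\Lambda_6^{H,2}\setminus\Lambda_{m+n}^{H,2}}A^u_{m',n',m,n}\frac{x^{m'}y^{n'}}{m'!n'!},$$ $$Q_{m,n}(x,y)=\sum_{\ell=1}^{1+\lfloor m/2\rfloor}\frac{(-1)^\ell y^{n+2\ell}x^{m-2\ell+2}}{(n+2\ell)!(m-2\ell+2)!}\frac1{a(p)}+\sum_{(m',n')\in\Lambda_6^{H,2}\setminus\Lambda_{m+n+2}^{H,2}}A^f_{m',n',m,n}\frac{x^{m'}y^{n'}}{m'!n'!}.$$ A 6-point scheme at $p$ consists of coefficients depending on $h>0$ (and on $a,\beta$, not on $u,f,g_4$) in $$\sum_{k=-1}^{1}\sum_{\ell=-1}^{0}C_{k,\ell}(h)\,u_h(x_0+kh,l_4+\ell h)=\sum_{(m,n)\in\Lambda_{N}}f^{(m,n)}C_{f,m,n}(h)+\sum_{n=0}^{N'}g_4^{(n)}C_{g_4,n}(h)$$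 (for some $N,N'$) with $\sum_{k,\ell}|C_{k,\ell}(h)|\ge\delta>0$ for all small $h$. It has order of accuracy $P$ if, for every solution $(u,f,g_4)$ of the problem in the smoothness class considered, the left-hand side with $u$ in place of $u_h$ minus the right-hand side is $O(h^{P+1})$ as $h\to0^+$, i.e. $O(h^P)$ after division by $h$. **(i)** Let $a$ be piecewise $C^6$ and $\beta$ piecewise $C^5$. Consider $C_{k,\ell}(h)=\sum_{i=0}^{6}c_{k,\ell,i}h^i$ satisfying, for $n=0,1,\dots,6$, $$\sum_{k=-1}^{1}\sum_{\ell=-1}^{0}C_{k,\ell}\Big(G_{n,0}(kh,\ell h)-\sum_{i=n}^{5}\binom in\beta^{(i-n)}G_{i,1}(kh,\ell h)\Big)=O(h^7)$$ (the inner sum is empty for $n=6$). This system has a nontrivial solution, i.e. one with $c_{k,\ell,0}\ne0$ for some $(k,\ell)$. For every solution, the scheme with $C_{f,m,n}=\sum_{k,\ell}C_{k,\ell}Q_{m,n}(kh,\ell h)$ for $(m,n)\in\Lambda_4$ and $C_{g_4,n}=\sum_{k,\ell}C_{k,\ell}G_{n,1}(kh,\ell h)$ for $0\le n\le5$ has a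 residual $O(h^7)$ for all solutions of the problem with $u$ piecewise $C^7$, $f$ piecewise $C^5$, $g_4$ piecewise $C^5$. In particular every nontrivial solution gives a 6-point scheme of order of accuracy six. **(ii)** Six is the maximum order of accuracy of a 6-point scheme at $p$ for (piecewise) smooth $\beta$ and $a$ in general position: for all smooth $a,\beta$ with $2a(p)\beta(x_0)\neq\partial_y a(p)$, the largest $P$ for which there is a 6-point scheme of order $P$ on smooth solutions is $6$. Consequently, $6$ is also the largest $P$ such that, for all smooth $a$ and $\beta$, there is a 6-point scheme of order $P$ on smooth solutions. -/

import Mathlib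

open Filter Topology Asymptotics
open scoped ContDiff Nat

noncomputable section

/-! ### The rectangle, the interface and the data -/

/-- The rectangle `Ω = (l₁, l₂) × (l₃, l₄)` together with the smooth level-set function `ψ` whose
zero set is the interface. -/
structure InterfaceDomain where
  l₁ : ℝ
  l₂ : ℝ
  l₃ : ℝ
  l₄ : ℝ
  lt₁₂ : l₁ < l₂
  lt₃₄ : l₃ < l₄
  ψ : ℝ × ℝ → ℝ
  smooth_ψ : ContDiff ℝ ∞ ψ

namespace InterfaceDomain

variable (D : InterfaceDomain)

/-- The open rectangle `Ω`. -/
def Ω : Set (ℝ × ℝ) := Set.Ioo D.l₁ D.l₂ ×ˢ Set.Ioo D.l₃ D.l₄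

/-- The interface `Γ_I`. -/
def interface : Set (ℝ × ℝ) := {q | q ∈ D.Ω ∧ D.ψ q = 0}

/-- The closed rectangle. -/
def box : Set (ℝ × ℝ) := Set.Icc D.l₁ D.l₂ ×ˢ Set.Icc D.l₃ D.l₄

/-- The closed rectangle without the zero set of `ψ`: the two subregions `Ω⁺` and `Ω⁻`, each
together with the part of the boundary of the rectangle that belongs to it. Since `ψ` is
continuous, the two pieces are relatively open in the closed rectangle and disjoint, so regularity
on this set is regularity up to the outer boundary in each of the two pieces (and nothing is asked
across the interface). -/
def regularSet : Set (ℝ × ℝ) := {q | q ∈ D.box ∧ D.ψ q ≠ 0}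

/-- Abscissae of the points of the upper side `Γ₄ = (l₁, l₂) × {l₄}` off the zero set of `ψ`. -/
def regularTop : Set ℝ := {x | x ∈ Set.Ioo D.l₁ D.l₂ ∧ D.ψ (x, D.l₄) ≠ 0}

/-- `∂v/∂x` on the closed rectangle (one-sided on its boundary). -/
def dx (v : ℝ × ℝ → ℝ) (q : ℝ × ℝ) : ℝ := fderivWithin ℝ v D.box q (1, 0)

/-- `∂v/∂y` on the closed rectangle (one-sided on its boundary). -/
def dy (v : ℝ × ℝ → ℝ) (q : ℝ × ℝ) : ℝ := fderivWithin ℝ v D.box q (0, 1)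

/-- `∂^{m+n} v / ∂x^m ∂y^n` on the closed rectangle (one-sided on its boundary). -/
def pd (m n : ℕ) (v : ℝ × ℝ → ℝ) : ℝ × ℝ → ℝ := D.dx^[m] (D.dy^[n] v)

/-- `∇ · (a ∇ u)`. -/
def divGrad (a u : ℝ × ℝ → ℝ) (q : ℝ × ℝ) : ℝ :=
  D.dx (fun z => a z * D.dx u z) q + D.dy (fun z => a z * D.dy u z) q

/-- Admissible coefficients: `a` is positive and of class `C^ka`, the Robin coefficient `β` is of
class `C^kb`, on either side of the interface and up to the boundary. -/
structure IsCoefficients (ka kb : WithTop ℕ∞) (a : ℝ × ℝ → ℝ) (β : ℝ → ℝ) : Prop where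
  pos : ∀ q ∈ D.regularSet, 0 < a q
  contDiff_a : ContDiffOn ℝ ka a D.regularSet
  contDiff_β : ContDiffOn ℝ kb β D.regularTop

/-- `u` (piecewise of class `C^ku`) solves `-∇ · (a ∇ u) = f` in `Ω \ Γ_I` with the Robin condition
`∂u/∂n + β u = g` on `Γ₄`, whose outward unit normal is `(0, 1)`; `f` is piecewise `C^kf`, `g` is
`C^kg`. The jumps of `u` across the interface and its boundary values on the three other sides are
free data of the problem. -/
structure IsSolution (a : ℝ × ℝ → ℝ) (β : ℝ → ℝ) (ku kf kg : WithTop ℕ∞)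
    (u f : ℝ × ℝ → ℝ) (g : ℝ → ℝ) : Prop where
  contDiff_u : ContDiffOn ℝ ku u D.regularSet
  contDiff_f : ContDiffOn ℝ kf f D.regularSet
  contDiff_g : ContDiffOn ℝ kg g D.regularTop
  pde : ∀ q ∈ D.Ω \ D.interface, - D.divGrad a u q = f q
  robin : ∀ x ∈ D.regularTop, D.dy u (x, D.l₄) + β x * u (x, D.l₄) = g x

end InterfaceDomain

/-! ### Index sets and the functions `G^H`, `Q^H` -/

/-- `Λ_N = {(m, n) : m + n ≤ N}`. -/
def Lam (N : ℕ) : Finset (ℕ × ℕ) :=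
  (Finset.range (N + 1) ×ˢ Finset.range (N + 1)).filter fun q => q.1 + q.2 ≤ N

/-- `Λ_N^{H,1}`: the indices of `Λ_N` with at most one derivative in `y`. -/
def LamH1 (N : ℕ) : Finset (ℕ × ℕ) := (Lam N).filter fun q => q.2 ≤ 1

/-- `Λ_N^{H,2} = Λ_N \ Λ_N^{H,1}`. -/
def LamH2 (N : ℕ) : Finset (ℕ × ℕ) := Lam N \ LamH1 N

/-- The recursion by which the equation determines all partial derivatives of a solution at a
point. Let `P, Q, R` be the partial derivatives there of `a_x / a`, `a_y / a`, `1 / a`, let `F` be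
those of `f`, and let `v m = u^{(m,0)}`, `w m = u^{(m,1)}`. Applying `∂_x^m ∂_y^n` to
`u_yy = - u_xx - (a_x / a) u_x - (a_y / a) u_y - (1 / a) f` gives `u^{(m, n+2)}`. -/
def jetOf (P Q R F : ℕ → ℕ → ℝ) (v w : ℕ → ℝ) : ℕ → ℕ → ℝ
  | m, 0 => v m
  | m, 1 => w m
  | m, n + 2 =>
      - jetOf P Q R F v w (m + 2) n
      - ∑ i ∈ Finset.range (m + 1), ∑ j ∈ Finset.range (n + 1),
          (m.choose i : ℝ) * (n.choose j : ℝ) *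
            (P i j * jetOf P Q R F v w (m - i + 1) (n - j)
              + Q i j * jetOf P Q R F v w (m - i) (n - j + 1)
              + R i j * F (m - i) (n - j))
termination_by _ n => n

namespace InterfaceDomain

variable (D : InterfaceDomain) (a : ℝ × ℝ → ℝ) (p : ℝ × ℝ)

/-- `jetOf` for the coefficient `a` at the base point `p`. -/
def jet (F : ℕ → ℕ → ℝ) (v w : ℕ → ℝ) : ℕ → ℕ → ℝ :=
  jetOf (fun i j => D.pd i j (fun q => D.dx a q / a q) p)
    (fun i j => D.pd i j (fun q => D.dy a q / a q) p)
    (fun i j => D.pd i j (fun q => 1 / a q) p) F v w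

/-- `A^{H,u}_{m',n',m,n}`: the coefficient of `u^{(m,n)}` (where `n ≤ 1`) in the expression of
`u^{(m',n')}` through the `u^{(i,0)}`, the `u^{(i,1)}` and the derivatives of `f`. -/
def AHu (m' n' m n : ℕ) : ℝ :=
  D.jet a p (fun _ _ => 0) (fun i => if i = m ∧ n = 0 then 1 else 0)
    (fun i => if i = m ∧ n = 1 then 1 else 0) m' n'

/-- `A^{H,f}_{m',n',m,n}`: the coefficient of `f^{(m,n)}` in the same expression. -/
def AHf (m' n' m n : ℕ) : ℝ :=
  D.jet a p (fun i j => if i = m ∧ j = n then 1 else 0) (fun _ => 0) (fun _ => 0) m' n'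

/-- `G^H_{M,m,n}(x, y)` with base point `p`. -/
def GH (M m n : ℕ) (x y : ℝ) : ℝ :=
  ∑ l ∈ Finset.range (m / 2 + 1),
      (-1) ^ l * (y ^ (n + 2 * l) * x ^ (m - 2 * l)) / ((n + 2 * l)! * (m - 2 * l)! : ℝ)
  + ∑ q ∈ LamH2 (M + 1) \ LamH2 (m + n),
      D.AHu a p q.1 q.2 m n * (x ^ q.1 * y ^ q.2 / (q.1 ! * q.2 ! : ℝ))

/-- `Q^H_{M,m,n}(x, y)` with base point `p`. -/
def QH (M m n : ℕ) (x y : ℝ) : ℝ :=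
  ∑ l ∈ Finset.Icc 1 (1 + m / 2),
      (-1) ^ l * (y ^ (n + 2 * l) * x ^ (m + 2 - 2 * l)) / ((n + 2 * l)! * (m + 2 - 2 * l)! : ℝ)
        * (1 / a p)
  + ∑ q ∈ LamH2 (M + 1) \ LamH2 (m + n + 2),
      D.AHf a p q.1 q.2 m n * (x ^ q.1 * y ^ q.2 / (q.1 ! * q.2 ! : ℝ))

end InterfaceDomain

/-! ### Six-point schemes at a point of the upper side -/

/-- Sum over the six stencil indices `(k, ℓ)`, `k ∈ {-1, 0, 1}`, `ℓ ∈ {-1, 0}`. -/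
def stencilSum (t : ℤ → ℤ → ℝ) : ℝ :=
  ∑ k ∈ Finset.Icc (-1 : ℤ) 1, ∑ l ∈ Finset.Icc (-1 : ℤ) 0, t k l

/-- A six-point scheme at a point of the upper side: for every mesh size `h` stencil coefficients
`C k ℓ h`, and a right-hand side that combines derivatives of `f` and of `g` at that point, of
orders up to `ordF` and `ordG`, with coefficients `Cf m n h` and `Cg n h`. -/
structure SixPointScheme where
  C : ℤ → ℤ → ℝ → ℝ
  ordF : ℕ
  ordG : ℕ
  Cf : ℕ → ℕ → ℝ → ℝ
  Cg : ℕ → ℝ → ℝ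

namespace SixPointScheme

variable (S : SixPointScheme)

/-- The stencil coefficients do not degenerate as `h → 0⁺` (otherwise a mere multiplication of the
scheme by a power of `h` would raise its formal order). -/
def IsNormalized : Prop :=
  ∃ δ : ℝ, 0 < δ ∧ ∀ᶠ h in 𝓝[>] (0 : ℝ), δ ≤ stencilSum fun k l => |S.C k l h|

/-- Left-hand side minus right-hand side of the scheme at `(x₀, l₄)`, for `u`, `f`, `g`. -/
def residual (D : InterfaceDomain) (x₀ : ℝ) (u f : ℝ × ℝ → ℝ) (g : ℝ → ℝ) (h : ℝ) : ℝ :=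
  (stencilSum fun k l => S.C k l h * u (x₀ + k * h, D.l₄ + l * h))
    - (∑ q ∈ Lam S.ordF, D.pd q.1 q.2 f (x₀, D.l₄) * S.Cf q.1 q.2 h
      + ∑ n ∈ Finset.range (S.ordG + 1), iteratedDeriv n g x₀ * S.Cg n h)

/-- Consistency of order `P` on the solutions of the given smoothness: the residual is
`O(h^(P+1))`, that is, `O(h^P)` after division by `h`. The scheme discretizes `h` times the
first-order boundary operator, whence the division. -/
def IsConsistent (D : InterfaceDomain) (x₀ : ℝ) (a : ℝ × ℝ → ℝ) (β : ℝ → ℝ)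
    (ku kf kg : WithTop ℕ∞) (P : ℕ) : Prop :=
  ∀ (u f : ℝ × ℝ → ℝ) (g : ℝ → ℝ), D.IsSolution a β ku kf kg u f g →
    (fun h => S.residual D x₀ u f g h) =O[𝓝[>] (0 : ℝ)] fun h => h ^ (P + 1)

/-- The scheme achieves the order of accuracy `P` at `(x₀, l₄)`. -/
def HasAccuracyOrder (D : InterfaceDomain) (x₀ : ℝ) (a : ℝ × ℝ → ℝ) (β : ℝ → ℝ)
    (ku kf kg : WithTop ℕ∞) (P : ℕ) : Prop :=
  S.IsNormalized ∧ S.IsConsistent D x₀ a β ku kf kg P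

end SixPointScheme

/-! ### The scheme of sixth order -/

/-- `C_{k,ℓ}(h) = ∑_{i=0}^{6} c_{k,ℓ,i} h^i`. -/
def polyCoeff (c : ℤ → ℤ → ℕ → ℝ) (k l : ℤ) (h : ℝ) : ℝ :=
  ∑ i ∈ Finset.range 7, c k l i * h ^ i

/-- Non-triviality of a solution: the stencil does not vanish at `h = 0`. -/
def IsNontrivial (c : ℤ → ℤ → ℕ → ℝ) : Prop :=
  ∃ k ∈ Finset.Icc (-1 : ℤ) 1, ∃ l ∈ Finset.Icc (-1 : ℤ) 0, c k l 0 ≠ 0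

/-- The linear system for the coefficients `c_{k,ℓ,i}`: for `n = 0, …, 6`
`∑_{k,ℓ} C_{k,ℓ} (G^H_{5,n,0}(kh, ℓh)
  - ∑_{i=n}^{5} (i choose n) β^{(i-n)} G^H_{5,i,1}(kh, ℓh) (1 - δ_{n,6})) = O(h^7)`. -/
def SolvesSystem (D : InterfaceDomain) (x₀ : ℝ) (a : ℝ × ℝ → ℝ) (β : ℝ → ℝ)
    (c : ℤ → ℤ → ℕ → ℝ) : Prop :=
  ∀ n ∈ Finset.range 7,
    (fun h : ℝ => stencilSum fun k l => polyCoeff c k l h *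
      (D.GH a (x₀, D.l₄) 5 n 0 (k * h) (l * h)
        - ∑ i ∈ Finset.Icc n 5, (i.choose n : ℝ) * iteratedDeriv (i - n) β x₀ *
            D.GH a (x₀, D.l₄) 5 i 1 (k * h) (l * h) * (1 - if n = 6 then 1 else 0)))
      =O[𝓝[>] (0 : ℝ)] fun h => h ^ 7

/-- The scheme with stencil coefficients `C_{k,ℓ}(h)` and right-hand side
`∑_{(m,n) ∈ Λ_4} f^{(m,n)} C_{f,m,n} + ∑_{n=0}^{5} g^{(n)} C_{g,n}`, where
`C_{f,m,n} = ∑_{k,ℓ} C_{k,ℓ} Q^H_{5,m,n}(kh, ℓh)` and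
`C_{g,n} = ∑_{k,ℓ} C_{k,ℓ} G^H_{5,n,1}(kh, ℓh)`. -/
def robinScheme (D : InterfaceDomain) (x₀ : ℝ) (a : ℝ × ℝ → ℝ) (c : ℤ → ℤ → ℕ → ℝ) :
    SixPointScheme where
  C := polyCoeff c
  ordF := 4
  ordG := 5
  Cf m n h := stencilSum fun k l =>
    polyCoeff c k l h * D.QH a (x₀, D.l₄) 5 m n (k * h) (l * h)
  Cg n h := stencilSum fun k l =>
    polyCoeff c k l h * D.GH a (x₀, D.l₄) 5 n 1 (k * h) (l * h)

end

noncomputable section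

/-! ### Algebra of the jet recursion -/

section JetRecursion

variable {P Q R F F' : ℕ → ℕ → ℝ} {v v' w w' : ℕ → ℝ}

/-! The equation expresses every derivative of `u` at the base point linearly through the
`u^{(m,0)}`, the `u^{(m,1)}` and the derivatives of `f`. `GH` and `QH` are the degree-six Taylor
polynomials of the jets generated by unit data (`GH_eq_taylorSum`, `QH_eq_taylorSum`).
Differentiating the Robin condition along the side eliminates the `u^{(m,1)}`. What then multiplies
`u^{(n,0)}` is the Taylor polynomial of `robinJet n`, the formal solution with `f = g = 0` and
boundary values `(x - x₀)^n / n!`. The linear system says that the stencil annihilates these seven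
polynomials up to `O(h^7)` (`solvesSystem_iff`); consistency follows by Taylor expansion
(`isConsistent_robinScheme`).

Solvability: `robinJet n` starts in degree `n` with the harmonic polynomial `Re (x + iy)^n / n!`,
which does not depend on `a` or `β`. Sorting by powers of `h` gives a triangular system for the
successive coefficients `c_s`: `c_0` must annihilate the harmonic polynomials with `n ≤ 6`, as
`leadStencil` does, and `c_s` must have prescribed pairings with those of degree `n ≤ 6 - s`. On the
six points the pairings with `n ≤ 4` are independent, so an obstruction can occur only for `s = 1`,
`n = 5`. It comes from one relation between the degrees 1, 3, 5, and it vanishes by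
`leadStencil_nextPart`.

Optimality: on the six points `Re z^6 = Re z^2`. Order seven therefore makes the stencil annihilate,
up to `O(h)`, a combination of the degree `n + 1` parts for `n = 6` and `n = 2`. The pairings with
`n ≤ 4` force a bounded stencil to be a multiple of `leadStencil` up to `O(h)`, and on `leadStencil`
that combination is a nonzero multiple of `2β - a_y / a`. The test solutions are polynomials whose
data `f`, `g` vanish to high order at the base point, so the right-hand side of the scheme
contributes nothing, whatever its form. -/

lemma jetOf_zero_right (m : ℕ) : jetOf P Q R F v w m 0 = v m := by rw [jetOf]

lemma jetOf_one_right (m : ℕ) : jetOf P Q R F v w m 1 = w m := by rw [jetOf]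

/-- Each pass of the recursion trades `y`-derivatives of `u` without raising the total order, so
only finitely many data matter. This locality is what truncates all later sums to degree six. -/
lemma jetOf_congr (n m : ℕ) (hF : ∀ i j, i + j + 2 ≤ m + n → F i j = F' i j)
    (hv : ∀ i ≤ m + n, v i = v' i) (hw : ∀ i, i + 1 ≤ m + n → w i = w' i) :
    jetOf P Q R F v w m n = jetOf P Q R F' v' w' m n := by
  induction n using Nat.strong_induction_on generalizing m with
  | _ n ih =>
    match n with
    | 0 => rw [jetOf, jetOf]; exact hv m (by omega)
    | 1 => rw [jetOf, jetOf]; exact hw m (by omega)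
    | n + 2 =>
      have key : ∀ j < n + 2, ∀ i, i + j ≤ m + (n + 2) →
          jetOf P Q R F v w i j = jetOf P Q R F' v' w' i j := fun j hj i hij =>
        ih j hj i (fun a b h => hF a b (by omega)) (fun a h => hv a (by omega))
          (fun a h => hw a (by omega))
      rw [jetOf, jetOf, key n (by omega) (m + 2) (by omega)]
      congr 1
      refine Finset.sum_congr rfl fun i hi => Finset.sum_congr rfl fun j hj => ?_
      rw [Finset.mem_range] at hi hj
      rw [key (n - j) (by omega) (m - i + 1) (by omega), key (n - j + 1) (by omega) (m - i)
        (by omega), hF (m - i) (n - j) (by omega)]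

lemma jetOf_add_smul (c : ℝ) (n m : ℕ) :
    jetOf P Q R (fun i j => F i j + c * F' i j) (fun i => v i + c * v' i)
      (fun i => w i + c * w' i) m n
      = jetOf P Q R F v w m n + c * jetOf P Q R F' v' w' m n := by
  induction n using Nat.strong_induction_on generalizing m with
  | _ n ih =>
    match n with
    | 0 => simp only [jetOf_zero_right]
    | 1 => simp only [jetOf_one_right]
    | n + 2 =>
      rw [jetOf, jetOf, jetOf, ih n (by omega), mul_sub, Finset.mul_sum]
      simp only [Finset.mul_sum]
      have : ∀ A B S T S' : ℝ, S = T + S' → -(A + c * B) - S = -A - T + (c * -B - S') := by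
        intro A B S T S' h
        rw [h]; ring
      apply this
      rw [← Finset.sum_add_distrib]
      refine Finset.sum_congr rfl fun i hi => ?_
      rw [← Finset.sum_add_distrib]
      refine Finset.sum_congr rfl fun j hj => ?_
      rw [Finset.mem_range] at hi hj
      rw [ih (n - j) (by omega), ih (n - j + 1) (by omega)]
      ring

lemma jetOf_add (m n : ℕ) :
    jetOf P Q R F v w m n + jetOf P Q R F' v' w' m n
      = jetOf P Q R (fun i j => F i j + F' i j) (fun i => v i + v' i) (fun i => w i + w' i) m n := by
  simpa only [one_mul] using
    (jetOf_add_smul (P := P) (Q := Q) (R := R) (F := F) (F' := F') (v := v) (v' := v')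
      (w := w) (w' := w') 1 n m).symm

lemma jetOf_zero (m n : ℕ) :
    jetOf P Q R (fun _ _ => 0) (fun _ => 0) (fun _ => 0) m n = 0 := by
  have := jetOf_add_smul (P := P) (Q := Q) (R := R) (F := fun _ _ => 0) (F' := fun _ _ => 0)
    (v := fun _ => 0) (v' := fun _ => 0) (w := fun _ => 0) (w' := fun _ => 0) 1 n m
  simp only [mul_zero, add_zero, one_mul] at this
  linarith

lemma jetOf_eq_zero (m n : ℕ) (hF : ∀ i j, i + j + 2 ≤ m + n → F i j = 0)
    (hv : ∀ i ≤ m + n, v i = 0) (hw : ∀ i, i + 1 ≤ m + n → w i = 0) :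
    jetOf P Q R F v w m n = 0 := by
  rw [jetOf_congr n m hF hv hw, jetOf_zero]

lemma jetOf_sum {ι : Type*} (s : Finset ι) (c : ι → ℝ) (F : ι → ℕ → ℕ → ℝ) (v w : ι → ℕ → ℝ)
    (m n : ℕ) :
    jetOf P Q R (fun i j => ∑ t ∈ s, c t * F t i j) (fun i => ∑ t ∈ s, c t * v t i)
      (fun i => ∑ t ∈ s, c t * w t i) m n
      = ∑ t ∈ s, c t * jetOf P Q R (F t) (v t) (w t) m n := by
  classical
  induction s using Finset.induction_on with
  | empty => simpa using jetOf_zero m n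
  | insert t s ht ih =>
    simp only [Finset.sum_insert ht]
    rw [← ih, add_comm, ← jetOf_add_smul]
    simp only [add_comm]

/-- A Leibniz term that differentiates a coefficient leaves a derivative of too low an order on the
jet or on `F`. Only the undifferentiated coefficients survive. -/
lemma jetOf_succ_of_vanishing (m n : ℕ)
    (hJ : ∀ i j, i + j < m + n + 1 → jetOf P Q R F v w i j = 0)
    (hF : ∀ i j, i + j < m + n → F i j = 0) :
    jetOf P Q R F v w m (n + 2) = - jetOf P Q R F v w (m + 2) n
      - (P 0 0 * jetOf P Q R F v w (m + 1) n + Q 0 0 * jetOf P Q R F v w m (n + 1)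
        + R 0 0 * F m n) := by
  rw [jetOf]
  congr 1
  rw [Finset.sum_eq_single_of_mem 0 (by simp), Finset.sum_eq_single_of_mem 0 (by simp)]
  · simp
  · intro j hj hj0
    rw [Finset.mem_range] at hj
    rw [hJ _ _ (by omega), hJ _ _ (by omega), hF _ _ (by omega)]
    ring
  · intro i hi hi0
    rw [Finset.mem_range] at hi
    refine Finset.sum_eq_zero fun j hj => ?_
    rw [Finset.mem_range] at hj
    rw [hJ _ _ (by omega), hJ _ _ (by omega), hF _ _ (by omega)]
    ring

end JetRecursion

lemma mem_Lam {N : ℕ} {q : ℕ × ℕ} : q ∈ Lam N ↔ q.1 + q.2 ≤ N := by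
  simp only [Lam, Finset.mem_filter, Finset.mem_product, Finset.mem_range]
  omega

lemma mem_LamH2 {N : ℕ} {q : ℕ × ℕ} : q ∈ LamH2 N ↔ q.1 + q.2 ≤ N ∧ 2 ≤ q.2 := by
  simp only [LamH2, LamH1, Finset.mem_sdiff, Finset.mem_filter, mem_Lam]
  omega

/-! ### Taylor polynomials with prescribed derivatives -/

/-- The homogeneous part of degree `d` of the Taylor series with derivatives `J`. -/
def homPart (J : ℕ → ℕ → ℝ) (d : ℕ) (x y : ℝ) : ℝ :=
  ∑ q ∈ Finset.HasAntidiagonal.antidiagonal d, J q.1 q.2 * (x ^ q.1 * y ^ q.2 / (q.1 ! * q.2 ! : ℝ))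

/-- The Taylor polynomial of degree `N` with derivatives `J`. -/
def taylorSum (J : ℕ → ℕ → ℝ) (N : ℕ) (x y : ℝ) : ℝ :=
  ∑ q ∈ Lam N, J q.1 q.2 * (x ^ q.1 * y ^ q.2 / (q.1 ! * q.2 ! : ℝ))

lemma taylorSum_mul (J : ℕ → ℕ → ℝ) (N : ℕ) (k l h : ℝ) :
    taylorSum J N (k * h) (l * h) = ∑ d ∈ Finset.range (N + 1), h ^ d * homPart J d k l := by
  rw [taylorSum, ← Finset.sum_fiberwise_of_maps_to (g := fun q => q.1 + q.2)
    (t := Finset.range (N + 1)) (fun q hq => by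
      rw [mem_Lam] at hq; exact Finset.mem_range.2 (by omega))]
  refine Finset.sum_congr rfl fun d hd => ?_
  rw [Finset.mem_range] at hd
  rw [homPart, Finset.mul_sum]
  refine Finset.sum_congr ?_ fun q hq => ?_
  · ext q
    simp only [Finset.mem_filter, mem_Lam, Finset.HasAntidiagonal.mem_antidiagonal]
    omega
  · rw [Finset.HasAntidiagonal.mem_antidiagonal] at hq
    rw [← hq, mul_pow, mul_pow, pow_add]
    ring

/-! ### `GH` and `QH` as Taylor polynomials of unit jets. -/

namespace InterfaceDomain

variable (D : InterfaceDomain) (a : ℝ × ℝ → ℝ) (p : ℝ × ℝ)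

lemma AHu_eq_zero {m n m' n' : ℕ} (h : m' + n' < m + n) :
    D.AHu a p m' n' m n = 0 := by
  refine jetOf_eq_zero _ _ (fun _ _ _ => rfl) (fun i hi => if_neg ?_) (fun i hi => if_neg ?_) <;>
  omega

lemma AHf_eq_zero {m n m' n' : ℕ} (h : m' + n' < m + n + 2) :
    D.AHf a p m' n' m n = 0 := by
  refine jetOf_eq_zero _ _ (fun i j hi => if_neg ?_) (fun _ _ => rfl) (fun _ _ => rfl)
  omega

/-- At lowest order the equation reads `u_yy = -u_xx`, so every pair of `y`-derivatives costs one
sign. This is the harmonic first sum of `GH`. -/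
lemma AHu_leading {m n : ℕ} (n' m' : ℕ) (h : m' + n' = m + n) :
    D.AHu a p m' n' m n = if n' % 2 = n then (-1) ^ (n' / 2) else 0 := by
  induction n' using Nat.strong_induction_on generalizing m' with
  | _ n' ih =>
    match n' with
    | 0 =>
      rw [AHu, jet, jetOf_zero_right]
      have : (m' = m ∧ n = 0) ↔ 0 % 2 = n := by omega
      simp [this]
    | 1 =>
      rw [AHu, jet, jetOf_one_right]
      have : (m' = m ∧ n = 1) ↔ 1 % 2 = n := by omega
      simp [this]
    | n' + 2 =>
      have h2 := ih n' (by omega) (m' + 2) (by omega)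
      have h0 : ∀ i j, i + j < m' + n' + 2 → D.AHu a p i j m n = 0 := fun i j hij =>
        D.AHu_eq_zero a p (by omega)
      rw [AHu, jet, jetOf_succ_of_vanishing _ _ (fun i j hij => h0 i j (by omega))
        (fun _ _ _ => rfl)]
      have h3 := h0 (m' + 1) n' (by omega)
      have h4 := h0 m' (n' + 1) (by omega)
      rw [AHu, jet] at h2 h3 h4
      rw [h2, h3, h4, show (n' + 2) % 2 = n' % 2 by omega, show (n' + 2) / 2 = n' / 2 + 1 by omega]
      split_ifs <;> ring

/-- The source first enters `u^{(m,n+2)}` through `-f / a`; from there on the alternation of `u_yy =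
-u_xx` takes over. -/
lemma AHf_leading {m n : ℕ} (n' m' : ℕ) (h : m' + n' = m + n + 2) :
    D.AHf a p m' n' m n
      = if n + 2 ≤ n' ∧ n' % 2 = n % 2 then (-1) ^ ((n' - n) / 2) * (1 / a p) else 0 := by
  induction n' using Nat.strong_induction_on generalizing m' with
  | _ n' ih =>
    match n' with
    | 0 => rw [AHf, jet, jetOf_zero_right, if_neg (by omega)]
    | 1 => rw [AHf, jet, jetOf_one_right, if_neg (by omega)]
    | n' + 2 =>
      have h2 := ih n' (by omega) (m' + 2) (by omega)
      have h0 : ∀ i j, i + j < m' + n' + 2 → D.AHf a p i j m n = 0 := fun i j hij =>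
        D.AHf_eq_zero a p (by omega)
      rw [AHf, jet, jetOf_succ_of_vanishing _ _ (fun i j hij => h0 i j (by omega))
        (fun i j hij => if_neg (by omega))]
      have h3 := h0 (m' + 1) n' (by omega)
      have h4 := h0 m' (n' + 1) (by omega)
      rw [AHf, jet] at h2 h3 h4
      rw [h2, h3, h4]
      have hR : D.pd 0 0 (fun q => 1 / a q) p = 1 / a p := rfl
      rw [hR]
      rcases lt_trichotomy n' n with hlt | rfl | hgt
      · rw [if_neg (by omega), if_neg (by omega), if_neg (by omega)]; ring
      · rw [if_neg (by omega), if_pos (by omega), if_pos (by omega),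
          show (n' + 2 - n') / 2 = 1 by omega]
        ring
      · rw [if_neg (show ¬ (m' = m ∧ n' = n) by omega)]
        by_cases hp : n' % 2 = n % 2
        · rw [if_pos (by omega), if_pos (by omega),
            show (n' + 2 - n) / 2 = (n' - n) / 2 + 1 by omega]
          ring
        · rw [if_neg (by omega), if_neg (by omega)]; ring

/-- The unit jet vanishes below degree `m + n`, is harmonic in that degree, and above it can be
nonzero only where `n' ≥ 2`, since entries with `n' ≤ 1` are data. The last two ranges are the two
sums of `GH`. -/
lemma GH_eq_taylorSum {m n : ℕ} (hn : n ≤ 1) (hmn : m + n ≤ 6) (x y : ℝ) :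
    D.GH a p 5 m n x y = taylorSum (fun i j => D.AHu a p i j m n) 6 x y := by
  have hsub : LamH2 (5 + 1) \ LamH2 (m + n) ⊆ Lam 6 := fun q hq => by
    rw [Finset.mem_sdiff, mem_LamH2] at hq
    rw [mem_Lam]; omega
  rw [GH, taylorSum, ← Finset.sum_sdiff hsub]
  congr 1
  -- The Taylor sum also runs over entries that vanish, so only nonzero terms are matched; the
  -- inverse map is `l = n' / 2`.
  refine Finset.sum_bij_ne_zero (fun l _ _ => (m - 2 * l, n + 2 * l)) ?_ ?_ ?_ ?_
  · intro l hl _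
    rw [Finset.mem_range] at hl
    simp only [Finset.mem_sdiff, mem_LamH2, mem_Lam]
    omega
  · intro l hl _ l' hl' _ h
    simp only [Prod.mk.injEq] at h
    omega
  · intro q hq hne
    simp only [Finset.mem_sdiff, mem_LamH2, mem_Lam] at hq
    have hA : D.AHu a p q.1 q.2 m n ≠ 0 := fun h0 => hne (by rw [h0, zero_mul])
    have hge : m + n ≤ q.1 + q.2 := by
      by_contra hlt
      exact hA (D.AHu_eq_zero a p (by omega))
    have heq : q.1 + q.2 = m + n := by
      by_contra hne'
      have hq2 : q.2 ≤ 1 := by omega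
      apply hA
      rw [AHu, jet]
      rcases Nat.le_one_iff_eq_zero_or_eq_one.1 hq2 with h0 | h0
      · rw [h0, jetOf_zero_right, if_neg (by omega)]
      · rw [h0, jetOf_one_right, if_neg (by omega)]
    rw [D.AHu_leading a p _ _ heq] at hA
    have hpar : q.2 % 2 = n := by
      by_contra hne'
      exact hA (if_neg hne')
    have hq' : (m - 2 * (q.2 / 2), n + 2 * (q.2 / 2)) = q := by
      ext <;> simp only <;> omega
    refine ⟨q.2 / 2, Finset.mem_range.2 (by omega), ?_, hq'⟩
    obtain ⟨h1, h2⟩ := Prod.ext_iff.1 hq'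
    simp only at h1 h2
    rw [D.AHu_leading a p _ _ heq, if_pos hpar] at hne
    rw [h1, h2]
    intro h0
    apply hne
    rw [← h0]; ring
  · intro l hl _
    rw [Finset.mem_range] at hl
    simp only
    rw [D.AHu_leading a p _ _ (by omega), if_pos (by omega),
      show (n + 2 * l) / 2 = l by omega]
    ring

lemma QH_eq_taylorSum {m n : ℕ} (hmn : m + n ≤ 4) (x y : ℝ) :
    D.QH a p 5 m n x y = taylorSum (fun i j => D.AHf a p i j m n) 6 x y := by
  have hsub : LamH2 (5 + 1) \ LamH2 (m + n + 2) ⊆ Lam 6 := fun q hq => by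
    rw [Finset.mem_sdiff, mem_LamH2] at hq
    rw [mem_Lam]; omega
  rw [QH, taylorSum, ← Finset.sum_sdiff hsub]
  congr 1
  refine Finset.sum_bij_ne_zero (fun l _ _ => (m + 2 - 2 * l, n + 2 * l)) ?_ ?_ ?_ ?_
  · intro l hl _
    rw [Finset.mem_Icc] at hl
    simp only [Finset.mem_sdiff, mem_LamH2, mem_Lam]
    omega
  · intro l hl _ l' hl' _ h
    simp only [Prod.mk.injEq] at h
    omega
  · intro q hq hne
    simp only [Finset.mem_sdiff, mem_LamH2, mem_Lam] at hq
    have hA : D.AHf a p q.1 q.2 m n ≠ 0 := fun h0 => hne (by rw [h0, zero_mul])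
    have hge : m + n + 2 ≤ q.1 + q.2 := by
      by_contra hlt
      exact hA (D.AHf_eq_zero a p (by omega))
    have heq : q.1 + q.2 = m + n + 2 := by
      by_contra hne'
      have hq2 : q.2 ≤ 1 := by omega
      apply hA
      rw [AHf, jet]
      rcases Nat.le_one_iff_eq_zero_or_eq_one.1 hq2 with h0 | h0
      · rw [h0, jetOf_zero_right]
      · rw [h0, jetOf_one_right]
    rw [D.AHf_leading a p _ _ heq] at hA
    have hpar : n + 2 ≤ q.2 ∧ q.2 % 2 = n % 2 := by
      by_contra hne'
      exact hA (if_neg hne')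
    have hq' : (m + 2 - 2 * ((q.2 - n) / 2), n + 2 * ((q.2 - n) / 2)) = q := by
      ext <;> simp only <;> omega
    refine ⟨(q.2 - n) / 2, Finset.mem_Icc.2 (by omega), ?_, hq'⟩
    obtain ⟨h1, h2⟩ := Prod.ext_iff.1 hq'
    simp only at h1 h2
    rw [D.AHf_leading a p _ _ heq, if_pos hpar] at hne
    rw [h1, h2]
    intro h0
    apply hne
    rw [← h0]; ring
  · intro l hl _
    rw [Finset.mem_Icc] at hl
    simp only
    rw [D.AHf_leading a p _ _ (by omega), if_pos (by omega),
      show (n + 2 * l - n) / 2 = l by omega]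
    ring

/-- Superposition of unit data. The ranges come from locality: a derivative of order six involves
`v` up to order six, `w` up to five and `F` up to four. -/
lemma jet_eq_sum (F : ℕ → ℕ → ℝ) (v w : ℕ → ℝ) {m n : ℕ} (hmn : m + n ≤ 6) :
    D.jet a p F v w m n = ∑ i ∈ Finset.range 7, v i * D.AHu a p m n i 0
      + ∑ i ∈ Finset.range 6, w i * D.AHu a p m n i 1
      + ∑ q ∈ Lam 4, F q.1 q.2 * D.AHf a p m n q.1 q.2 := by
  simp only [AHu, AHf, jet]
  rw [← jetOf_sum, ← jetOf_sum, ← jetOf_sum]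
  rw [jetOf_add, jetOf_add]
  refine jetOf_congr _ _ (fun i j hij => ?_) (fun i hi => ?_) (fun i hi => ?_)
  · have : ∀ t : ℕ × ℕ, (i = t.1 ∧ j = t.2) ↔ t = (i, j) := fun t => by
      rw [Prod.ext_iff]; constructor <;> rintro ⟨h1, h2⟩ <;> exact ⟨h1.symm, h2.symm⟩
    simp only [this, mul_ite, mul_one, mul_zero, Finset.sum_ite_eq', mem_Lam,
      Finset.sum_const_zero, zero_add]
    rw [if_pos (by omega)]
  · simp [Finset.sum_ite_eq]
    omega
  · simp [Finset.sum_ite_eq]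
    omega

lemma taylorSum_jet (F : ℕ → ℕ → ℝ) (v w : ℕ → ℝ) (x y : ℝ) :
    taylorSum (D.jet a p F v w) 6 x y = ∑ i ∈ Finset.range 7, v i * D.GH a p 5 i 0 x y
      + ∑ i ∈ Finset.range 6, w i * D.GH a p 5 i 1 x y
      + ∑ q ∈ Lam 4, F q.1 q.2 * D.QH a p 5 q.1 q.2 x y := by
  have h1 : ∀ i ∈ Finset.range 7, v i * D.GH a p 5 i 0 x y
      = v i * taylorSum (fun m n => D.AHu a p m n i 0) 6 x y := fun i hi => by
    rw [Finset.mem_range] at hi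
    rw [D.GH_eq_taylorSum a p (by omega) (by omega)]
  have h2 : ∀ i ∈ Finset.range 6, w i * D.GH a p 5 i 1 x y
      = w i * taylorSum (fun m n => D.AHu a p m n i 1) 6 x y := fun i hi => by
    rw [Finset.mem_range] at hi
    rw [D.GH_eq_taylorSum a p (by omega) (by omega)]
  have h3 : ∀ q ∈ Lam 4, F q.1 q.2 * D.QH a p 5 q.1 q.2 x y
      = F q.1 q.2 * taylorSum (fun m n => D.AHf a p m n q.1 q.2) 6 x y := fun q hq => by
    rw [mem_Lam] at hq
    rw [D.QH_eq_taylorSum a p (by omega)]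
  rw [Finset.sum_congr rfl h1, Finset.sum_congr rfl h2, Finset.sum_congr rfl h3]
  simp only [taylorSum, Finset.mul_sum]
  rw [Finset.sum_comm, Finset.sum_comm (s := Finset.range 6), Finset.sum_comm (s := Lam 4),
    ← Finset.sum_add_distrib, ← Finset.sum_add_distrib]
  refine Finset.sum_congr rfl fun q hq => ?_
  rw [mem_Lam] at hq
  rw [D.jet_eq_sum a p F v w hq, add_mul, add_mul, Finset.sum_mul, Finset.sum_mul, Finset.sum_mul]
  simp only [mul_assoc]

end InterfaceDomain

/-! ### Solutions of the homogeneous equation with homogeneous Robin data -/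

/-- The coefficients `Re (i ^ j)` of the leading homogeneous part. -/
def leadCoeff : ℕ → ℝ
  | 0 => 1
  | 1 => 0
  | j + 2 => - leadCoeff j

/-- The coefficients of the homogeneous part that follows the leading one, for the values `b` of
`β`, `P` of `a_x / a` and `Q` of `a_y / a` at the base point. -/
def nextCoeff (b P Q : ℝ) : ℕ → ℝ
  | 0 => 0
  | 1 => - b
  | j + 2 => - nextCoeff b P Q j - (P * leadCoeff j + Q * leadCoeff (j + 1))

lemma homPart_congr {J J' : ℕ → ℕ → ℝ} {d : ℕ} (h : ∀ i j, i + j = d → J i j = J' i j) (x y : ℝ) :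
    homPart J d x y = homPart J' d x y :=
  Finset.sum_congr rfl fun q hq => by
    rw [h _ _ (Finset.HasAntidiagonal.mem_antidiagonal.1 hq)]

lemma homPart_eq_zero {J : ℕ → ℕ → ℝ} {d : ℕ} (h : ∀ i j, i + j = d → J i j = 0) (x y : ℝ) :
    homPart J d x y = 0 :=
  Finset.sum_eq_zero fun q hq => by
    rw [h _ _ (Finset.HasAntidiagonal.mem_antidiagonal.1 hq), zero_mul]

/-- A family of jets whose `n`-th member starts like the solution of the homogeneous equation with
homogeneous Robin data that restricts to `x ^ n / n!` on the boundary. -/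
structure IsRobinFamily (b P Q : ℝ) (J : ℕ → ℕ → ℕ → ℝ) : Prop where
  low : ∀ n i j, i + j < n → J n i j = 0
  lead : ∀ n i j, i + j = n → J n i j = leadCoeff j
  next : ∀ n i j, i + j = n + 1 → J n i j = nextCoeff b P Q j

namespace InterfaceDomain

variable (D : InterfaceDomain) (a : ℝ × ℝ → ℝ) (p : ℝ × ℝ) (b : ℕ → ℝ)

/-- The jet of a solution with `f = 0`, with `u(x, l₄) = (x - x₀) ^ n / n!` and with homogeneous
Robin data, where `b` are the derivatives of `β`. -/
def robinJet (n : ℕ) : ℕ → ℕ → ℝ :=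
  D.jet a p (fun _ _ => 0) (fun i => if i = n then 1 else 0)
    (fun m => - ((m.choose n : ℝ) * b (m - n)))

/-- The first-order terms of the equation and the term `βu` each cost one order of differentiation.
They first appear in degree `n + 1`, and there only through the values of `β`, `a_x / a`, `a_y / a`
at the base point. -/
lemma isRobinFamily_robinJet :
    IsRobinFamily (b 0) (D.dx a p / a p) (D.dy a p / a p) (D.robinJet a p b) := by
  have low : ∀ n i j, i + j < n → D.robinJet a p b n i j = 0 := fun n i j h =>
    jetOf_eq_zero _ _ (fun _ _ _ => rfl) (fun m hm => if_neg (by omega))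
      (fun m hm => by rw [Nat.choose_eq_zero_of_lt (by omega)]; simp)
  have lead : ∀ n j i, i + j = n → D.robinJet a p b n i j = leadCoeff j := by
    intro n j
    induction j using Nat.strong_induction_on with
    | _ j ih =>
      intro i h
      match j with
      | 0 => rw [robinJet, jet, jetOf_zero_right, if_pos (by omega), leadCoeff]
      | 1 =>
        rw [robinJet, jet, jetOf_one_right, Nat.choose_eq_zero_of_lt (by omega), leadCoeff]
        simp
      | j + 2 =>
        have h1 := ih j (by omega) (i + 2) (by omega)
        have h2 := low n (i + 1) j (by omega)
        have h3 := low n i (j + 1) (by omega)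
        rw [robinJet, jet] at h1 h2 h3
        rw [robinJet, jet, jetOf_succ_of_vanishing _ _ (fun k l hkl => low n k l (by omega))
          (fun _ _ _ => rfl), h1, h2, h3, leadCoeff]
        ring
  refine ⟨low, fun n i j => lead n j i, ?_⟩
  intro n i j
  induction j using Nat.strong_induction_on generalizing i with
  | _ j ih =>
    intro h
    match j with
    | 0 => rw [robinJet, jet, jetOf_zero_right, if_neg (by omega), nextCoeff]
    | 1 =>
      obtain rfl : i = n := by omega
      rw [robinJet, jet, jetOf_one_right, nextCoeff]
      simp
    | j + 2 =>
      have h1 := ih j (by omega) (i + 2) (by omega)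
      have h2 := lead n j (i + 1) (by omega)
      have h3 := lead n (j + 1) i (by omega)
      rw [robinJet, jet] at h1 h2 h3
      have key : D.robinJet a p b n i (j + 2) = - D.robinJet a p b n (i + 2) j
        - (D.dx a p / a p * D.robinJet a p b n (i + 1) j
          + D.dy a p / a p * D.robinJet a p b n i (j + 1)) := by
        rw [robinJet, jet, jetOf]
        congr 1
        have hlow : ∀ k l, k + l < n → D.robinJet a p b n k l = 0 := low n
        rw [robinJet, jet] at hlow
        rw [Finset.sum_eq_single_of_mem 0 (by simp), Finset.sum_eq_single_of_mem 0 (by simp)]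
        · simp [pd]
        · intro k hk hk0
          rw [Finset.mem_range] at hk
          rw [hlow _ _ (by omega), hlow _ _ (by omega)]
          ring
        · intro k hk hk0
          rw [Finset.mem_range] at hk
          refine Finset.sum_eq_zero fun l hl => ?_
          rw [Finset.mem_range] at hl
          rw [hlow _ _ (by omega), hlow _ _ (by omega)]
          ring
      rw [key, robinJet, jet, h1, h2, h3, nextCoeff]

lemma taylorSum_robinJet {n : ℕ} (hn : n < 7) (x y : ℝ) :
    taylorSum (D.robinJet a p b n) 6 x y = D.GH a p 5 n 0 x y
      - ∑ i ∈ Finset.Icc n 5, (i.choose n : ℝ) * b (i - n) *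
          D.GH a p 5 i 1 x y * (1 - if n = 6 then 1 else 0) := by
  have h6 : ∑ i ∈ Finset.Icc n 5, (i.choose n : ℝ) * b (i - n) *
      D.GH a p 5 i 1 x y * (1 - if n = 6 then 1 else 0)
      = ∑ i ∈ Finset.range 6, (i.choose n : ℝ) * b (i - n) * D.GH a p 5 i 1 x y := by
    -- For `i < n` the binomial coefficient vanishes, whatever the truncated `i - n` gives. For `n =
    -- 6` this removes every term, so the factor `1 - δ` changes nothing.
    rw [← Finset.sum_subset (s₁ := Finset.Icc n 5) (s₂ := Finset.range 6)]
    · refine Finset.sum_congr rfl fun i hi => ?_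
      rw [Finset.mem_Icc] at hi
      rw [if_neg (by omega)]
      ring
    · intro i hi
      rw [Finset.mem_Icc] at hi
      exact Finset.mem_range.2 (by omega)
    · intro i hi hi'
      rw [Finset.mem_range] at hi
      rw [Finset.mem_Icc] at hi'
      rw [Nat.choose_eq_zero_of_lt (by omega)]
      simp
  rw [h6, robinJet, D.taylorSum_jet]
  simp [hn, sub_eq_add_neg]

end InterfaceDomain

/-! ### Moments of stencils -/

lemma stencilSum_eq (t : ℤ → ℤ → ℝ) :
    stencilSum t = t (-1) (-1) + t (-1) 0 + (t 0 (-1) + t 0 0) + (t 1 (-1) + t 1 0) := by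
  have h1 : Finset.Icc (-1 : ℤ) 1 = {-1, 0, 1} := by decide
  have h2 : Finset.Icc (-1 : ℤ) 0 = {-1, 0} := by decide
  rw [stencilSum, h1, h2]
  simp [add_assoc]

lemma stencilSum_add (s t : ℤ → ℤ → ℝ) :
    stencilSum (fun k l => s k l + t k l) = stencilSum s + stencilSum t := by
  simp only [stencilSum_eq]; ring

lemma stencilSum_sub (s t : ℤ → ℤ → ℝ) :
    stencilSum (fun k l => s k l - t k l) = stencilSum s - stencilSum t := by
  simp only [stencilSum_eq]; ring

lemma stencilSum_mul_left (r : ℝ) (t : ℤ → ℤ → ℝ) :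
    stencilSum (fun k l => r * t k l) = r * stencilSum t := by
  simp only [stencilSum_eq]; ring

lemma stencilSum_sum {ι : Type*} (s : Finset ι) (t : ι → ℤ → ℤ → ℝ) :
    stencilSum (fun k l => ∑ i ∈ s, t i k l) = ∑ i ∈ s, stencilSum (t i) := by
  simp only [stencilSum_eq, Finset.sum_add_distrib]

/-- The pairing of the stencil `C` with the homogeneous part of degree `d` of `J`. -/
def moment (J : ℕ → ℕ → ℝ) (d : ℕ) (C : ℤ → ℤ → ℝ) : ℝ :=
  stencilSum fun k l => C k l * homPart J d k l

lemma moment_eq_lead {b P Q : ℝ} {J : ℕ → ℕ → ℕ → ℝ} (hJ : IsRobinFamily b P Q J)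
    (C : ℤ → ℤ → ℝ) (n : ℕ) :
    moment (J n) n C = stencilSum fun k l => C k l * homPart (fun _ j => leadCoeff j) n k l := by
  simp only [moment, homPart_congr (hJ.lead n)]

lemma moment_eq_next {b P Q : ℝ} {J : ℕ → ℕ → ℕ → ℝ} (hJ : IsRobinFamily b P Q J)
    (C : ℤ → ℤ → ℝ) (n : ℕ) : moment (J n) (n + 1) C
    = stencilSum fun k l => C k l * homPart (fun _ j => nextCoeff b P Q j) (n + 1) k l := by
  simp only [moment, homPart_congr (hJ.next n)]

lemma moment_eq_zero {b P Q : ℝ} {J : ℕ → ℕ → ℕ → ℝ} (hJ : IsRobinFamily b P Q J)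
    (C : ℤ → ℤ → ℝ) {n d : ℕ} (hd : d < n) : moment (J n) d C = 0 := by
  simp only [moment, homPart_eq_zero (fun i j (h : i + j = d) => hJ.low n i j (by omega)), mul_zero,
    stencilSum_eq, add_zero]

/-- The leading homogeneous part `Re (x + i y) ^ n / n!`. -/
def leadPart (n : ℕ) (x y : ℝ) : ℝ := homPart (fun _ j => leadCoeff j) n x y

lemma leadPart_values :
    leadPart 0 = (fun _ _ => 1) ∧ leadPart 1 = (fun x _ => x) ∧
    leadPart 2 = (fun x y => (x ^ 2 - y ^ 2) / 2) ∧
    leadPart 3 = (fun x y => (x ^ 3 - 3 * x * y ^ 2) / 6) ∧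
    leadPart 4 = (fun x y => (x ^ 4 - 6 * x ^ 2 * y ^ 2 + y ^ 4) / 24) ∧
    leadPart 5 = (fun x y => (x ^ 5 - 10 * x ^ 3 * y ^ 2 + 5 * x * y ^ 4) / 120) ∧
    leadPart 6 = (fun x y => (x ^ 6 - 15 * x ^ 4 * y ^ 2 + 15 * x ^ 2 * y ^ 4 - y ^ 6) / 720) := by
  refine ⟨?_, ?_, ?_, ?_, ?_, ?_, ?_⟩ <;> ext x y <;>
  simp [leadPart, homPart, Finset.Nat.sum_antidiagonal_eq_sum_range_succ_mk, Finset.sum_range_succ,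
    leadCoeff, Nat.factorial] <;> ring

/-- The homogeneous part of degree `n + 1` of the `n`-th member of a Robin family. -/
def nextPart (b P Q : ℝ) (n : ℕ) (x y : ℝ) : ℝ :=
  homPart (fun _ j => nextCoeff b P Q j) (n + 1) x y

lemma nextPart_values (b P Q : ℝ) :
    nextPart b P Q 1 = (fun x y => - b * (x * y) - P * y ^ 2 / 2) ∧
    nextPart b P Q 2 = (fun x y => - b * (x ^ 2 * y) / 2 - P * (x * y ^ 2) / 2
      + (b + Q) * y ^ 3 / 6) ∧
    nextPart b P Q 3 = (fun x y => - b * (x ^ 3 * y) / 6 - P * (x ^ 2 * y ^ 2) / 4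
      + (b + Q) * (x * y ^ 3) / 6 + P * y ^ 4 / 12) ∧
    nextPart b P Q 5 = (fun x y => - b * (x ^ 5 * y) / 120 - P * (x ^ 4 * y ^ 2) / 48
      + (b + Q) * (x ^ 3 * y ^ 3) / 36 + P * (x ^ 2 * y ^ 4) / 24 - (b + 2 * Q) * (x * y ^ 5) / 120
      - P * y ^ 6 / 240) ∧
    nextPart b P Q 6 = (fun x y => - b * (x ^ 6 * y) / 720 - P * (x ^ 5 * y ^ 2) / 240
      + (b + Q) * (x ^ 4 * y ^ 3) / 144 + P * (x ^ 3 * y ^ 4) / 72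
      - (b + 2 * Q) * (x ^ 2 * y ^ 5) / 240 - P * (x * y ^ 6) / 240
      + (b + 3 * Q) * y ^ 7 / 5040) := by
  refine ⟨?_, ?_, ?_, ?_, ?_⟩ <;> ext x y <;>
  simp [nextPart, homPart, Finset.Nat.sum_antidiagonal_eq_sum_range_succ_mk,
    Finset.sum_range_succ, leadCoeff, nextCoeff, Nat.factorial] <;> ring

/-- The stencil with the values `E ± D` at `(±1, -1)`, `F ± K` at `(±1, 0)`, `A` at `(0, -1)` and
`B` at `(0, 0)`. -/
def stencilOf (A B E F D K : ℝ) (k l : ℤ) : ℝ :=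
  if l = 0 then (if k = 0 then B else F + k * K) else (if k = 0 then A else E + k * D)

lemma stencilSum_stencilOf (A B E F D K : ℝ) (t : ℝ → ℝ → ℝ) :
    (stencilSum fun k l => stencilOf A B E F D K k l * t k l)
      = (E - D) * t (-1) (-1) + (F - K) * t (-1) 0 + (A * t 0 (-1) + B * t 0 0)
        + ((E + D) * t 1 (-1) + (F + K) * t 1 0) := by
  simp [stencilSum_eq, stencilOf]
  ring

/-- Splitting by parity in `x`: degrees 0, 2, 4 give three conditions on the even weights `A, B, E,
F`, which leave the line spanned by `leadStencil`, removed here by `A = 0`. Degrees 1 and 3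
determine the odd weights `D, K`. On the stencil `2 L₁ - 30 L₃ + 360 L₅ = 0`, so degree 5 is a
compatibility condition. -/
lemma exists_stencil_of_leadPart (r : ℕ → ℝ) :
    ∃ C : ℤ → ℤ → ℝ, (∀ n < 5, (stencilSum fun k l => C k l * leadPart n k l) = r n) ∧
      (2 * r 1 - 30 * r 3 + 360 * r 5 = 0 →
        (stencilSum fun k l => C k l * leadPart 5 k l) = r 5) := by
  obtain ⟨h0, h1, h2, h3, h4, h5, -⟩ := leadPart_values
  refine ⟨stencilOf 0 (r 0 - (r 2 - 12 * r 4) / 2 - 2 * r 2) ((r 2 - 12 * r 4) / 4) (r 2)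
    ((r 1 - 6 * r 3) / 6) (r 1 / 2 - (r 1 - 6 * r 3) / 6), fun n hn => ?_, fun h => ?_⟩
  · rw [stencilSum_stencilOf]
    interval_cases n
    · rw [h0]; ring
    · rw [h1]; ring
    · rw [h2]; ring
    · rw [h3]; ring
    · rw [h4]; ring
  · rw [stencilSum_stencilOf, h5]
    linear_combination (- 1 / 360) * h

/-! ### Solvability of the linear system order by order in `h`. -/

lemma stencilSum_polyCoeff_isBigO (c : ℤ → ℤ → ℕ → ℝ) (J : ℕ → ℕ → ℝ)
    (h : ∀ e < 7, ∑ s ∈ Finset.range (e + 1), moment J (e - s) (fun k l => c k l s) = 0) :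
    (fun h : ℝ => stencilSum fun k l => polyCoeff c k l h * taylorSum J 6 (k * h) (l * h))
      =O[𝓝[>] (0 : ℝ)] fun h => h ^ 7 := by
  set X : ℕ → ℕ → ℝ := fun s d => moment J d fun k l => c k l s with hX
  have hsum : ∀ h : ℝ, (stencilSum fun k l => polyCoeff c k l h * taylorSum J 6 (k * h) (l * h))
      = ∑ s ∈ Finset.range 7, ∑ d ∈ Finset.range 7, h ^ s * h ^ d * X s d := by
    intro h
    simp only [hX, moment, taylorSum_mul, polyCoeff, Finset.sum_mul_sum, stencilSum_sum,
      ← stencilSum_mul_left]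
    refine Finset.sum_congr rfl fun s _ => Finset.sum_congr rfl fun d _ => ?_
    congr 1; ext k l; ring
  -- The coefficients of `h^e` with `e < 7` vanish by hypothesis. The inner sum collects the pairs
  -- `(s, d)` with `s + d = e + 7` and `s, d ≤ 6`.
  have hfac : ∀ h : ℝ, (stencilSum fun k l => polyCoeff c k l h * taylorSum J 6 (k * h) (l * h))
      = h ^ 7 * (∑ e ∈ Finset.range 6, h ^ e * ∑ i ∈ Finset.range (6 - e),
          X (e + 1 + i) (6 - i)) := by
    intro h'
    have e0 := h 0 (by norm_num)
    have e1 := h 1 (by norm_num)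
    have e2 := h 2 (by norm_num)
    have e3 := h 3 (by norm_num)
    have e4 := h 4 (by norm_num)
    have e5 := h 5 (by norm_num)
    have e6 := h 6 (by norm_num)
    rw [hsum]
    simp only [Finset.sum_range_succ, Finset.sum_range_zero, Nat.reduceSub, Nat.reduceAdd,
      zero_add, Nat.add_zero, tsub_zero, tsub_self] at e0 e1 e2 e3 e4 e5 e6 ⊢
    simp only [hX]
    linear_combination e0 + h' * e1 + h' ^ 2 * e2 + h' ^ 3 * e3 + h' ^ 4 * e4 + h' ^ 5 * e5
      + h' ^ 6 * e6
  simp only [hfac]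
  have hbd : (fun h : ℝ => ∑ e ∈ Finset.range 6, h ^ e * ∑ i ∈ Finset.range (6 - e),
      X (e + 1 + i) (6 - i)) =O[𝓝[>] (0 : ℝ)] fun _ => (1 : ℝ) := by
    have hcont : Continuous fun h : ℝ => ∑ e ∈ Finset.range 6, h ^ e *
        ∑ i ∈ Finset.range (6 - e), X (e + 1 + i) (6 - i) := by fun_prop
    exact ((hcont.tendsto 0).mono_left nhdsWithin_le_nhds).isBigO_one ℝ
  simpa using (isBigO_refl (fun h : ℝ => h ^ 7) (𝓝[>] (0 : ℝ))).mul hbd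

/-- The stencil that is exact to leading order for all harmonic polynomials of degree at most
six which are even in `y`. -/
def leadStencil : ℤ → ℤ → ℝ := stencilOf 4 (-10) 1 2 0 0

lemma leadStencil_leadPart {n : ℕ} (hn : n < 7) :
    (stencilSum fun k l => leadStencil k l * leadPart n k l) = 0 := by
  obtain ⟨h0, h1, h2, h3, h4, h5, h6⟩ := leadPart_values
  rw [leadStencil, stencilSum_stencilOf]
  interval_cases n
  · rw [h0]; norm_num
  · rw [h1]; norm_num
  · rw [h2]; norm_num
  · rw [h3]; norm_num
  · rw [h4]; norm_num
  · rw [h5]; norm_num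
  · rw [h6]; norm_num

/-- This is the compatibility condition for the first correction. `leadStencil` is even in `x`, so
for these odd `n` only the `P` terms contribute: `-6P` from `n = 1`, zero from `n = 3`, `6P` from `n
= 5`. -/
lemma leadStencil_nextPart (b P Q : ℝ) :
    (2 * (stencilSum fun k l => leadStencil k l * nextPart b P Q 1 k l)
      - 30 * (stencilSum fun k l => leadStencil k l * nextPart b P Q 3 k l)
      + 360 * stencilSum fun k l => leadStencil k l * nextPart b P Q 5 k l) = 0 := by
  obtain ⟨h1, -, h3, h5, -⟩ := nextPart_values b P Q
  rw [leadStencil, stencilSum_stencilOf, stencilSum_stencilOf, stencilSum_stencilOf, h1, h3, h5]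
  ring

/-- The system is triangular: at order `h^(n+s)` the new unknown `c s` meets `J n` only in its
leading part, and everything else is already known. -/
lemma exists_partial_solution {b P Q : ℝ} {J : ℕ → ℕ → ℕ → ℝ} (hJ : IsRobinFamily b P Q J)
    (t : ℕ) : ∃ c : ℕ → ℤ → ℤ → ℝ, c 0 = leadStencil ∧ ∀ s ≤ t, ∀ n, n + s ≤ 6 →
      ∑ i ∈ Finset.range (s + 1), moment (J n) (n + s - i) (c i) = 0 := by
  induction t with
  | zero =>
    refine ⟨fun _ => leadStencil, rfl, fun s hs n hn => ?_⟩
    obtain rfl : s = 0 := by omega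
    rw [Finset.sum_range_one]
    exact (moment_eq_lead hJ _ n).trans (leadStencil_leadPart (by omega))
  | succ t ih =>
    obtain ⟨c, hc0, hc⟩ := ih
    obtain ⟨C, hC, hC5⟩ := exists_stencil_of_leadPart
      fun n => - ∑ i ∈ Finset.range (t + 1), moment (J n) (n + (t + 1) - i) (c i)
    have hupd : ∀ i < t + 1, Function.update c (t + 1) C i = c i := fun i hi =>
      Function.update_of_ne (by omega) _ _
    refine ⟨Function.update c (t + 1) C, by rw [hupd 0 (by omega), hc0], fun s hs n hn => ?_⟩
    rcases Nat.lt_or_ge s (t + 1) with hlt | hge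
    · rw [← hc s (by omega) n hn]
      refine Finset.sum_congr rfl fun i hi => ?_
      rw [Finset.mem_range] at hi
      rw [hupd i (by omega)]
    · obtain rfl : s = t + 1 := by omega
      rw [Finset.sum_range_succ, Function.update_self, show n + (t + 1) - (t + 1) = n by omega,
        moment_eq_lead hJ]
      have hlead : (stencilSum fun k l => C k l * leadPart n k l)
          = - ∑ i ∈ Finset.range (t + 1), moment (J n) (n + (t + 1) - i) (c i) := by
        rcases Nat.lt_or_ge n 5 with h5 | h5
        · exact hC n h5
        -- From `n + (t + 1) ≤ 6`, degree five is needed only in the first correction, so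
        -- compatibility has to be checked only against `leadStencil`.
        · obtain rfl : n = 5 := by omega
          obtain rfl : t = 0 := by omega
          refine hC5 ?_
          simp only [zero_add, Finset.sum_range_one, tsub_zero, hc0, moment_eq_next hJ]
          have := leadStencil_nextPart b P Q
          simp only [nextPart] at this
          linarith
      simp only [leadPart] at hlead
      rw [hlead, ← sub_eq_add_neg, sub_eq_zero]
      refine Finset.sum_congr rfl fun i hi => ?_
      rw [Finset.mem_range] at hi
      rw [hupd i hi]

lemma exists_stencil_of_isRobinFamily {b P Q : ℝ} {J : ℕ → ℕ → ℕ → ℝ}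
    (hJ : IsRobinFamily b P Q J) :
    ∃ c : ℤ → ℤ → ℕ → ℝ, IsNontrivial c ∧ ∀ n < 7,
      (fun h : ℝ => stencilSum fun k l => polyCoeff c k l h * taylorSum (J n) 6 (k * h) (l * h))
        =O[𝓝[>] (0 : ℝ)] fun h => h ^ 7 := by
  obtain ⟨c, hc0, hc⟩ := exists_partial_solution hJ 6
  refine ⟨fun k l i => c i k l, ⟨0, by simp, 0, by simp, ?_⟩, fun n hn => ?_⟩
  · simp [hc0, leadStencil, stencilOf]
  · refine stencilSum_polyCoeff_isBigO _ _ fun e he => ?_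
    rcases Nat.lt_or_ge e n with hlt | hge
    · exact Finset.sum_eq_zero fun s _ => moment_eq_zero hJ _ (by omega)
    · obtain ⟨s, rfl⟩ := Nat.exists_eq_add_of_le hge
      rw [← hc s (by omega) n (by omega)]
      refine (Finset.sum_subset (Finset.range_subset_range.2 (by omega)) fun i hi hi' => ?_).symm
      rw [Finset.mem_range] at hi hi'
      exact moment_eq_zero hJ _ (by omega)

/-! ### The obstruction to order seven. -/

lemma isBigO_stencilSum {l : Filter ℝ} {t : ℤ → ℤ → ℝ → ℝ} {g : ℝ → ℝ}
    (ht : ∀ k ∈ Finset.Icc (-1 : ℤ) 1, ∀ m ∈ Finset.Icc (-1 : ℤ) 0, t k m =O[l] g) :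
    (fun h => stencilSum fun k m => t k m h) =O[l] g :=
  IsBigO.sum fun k hk => IsBigO.sum fun m hm => ht k hk m hm

lemma isBigO_of_pow_mul {f : ℝ → ℝ} (n m : ℕ)
    (hf : (fun h : ℝ => h ^ n * f h) =O[𝓝[>] (0 : ℝ)] fun h => h ^ (n + m)) :
    f =O[𝓝[>] (0 : ℝ)] fun h => h ^ m := by
  refine ((isBigO_refl (fun h : ℝ => (h ^ n)⁻¹) (𝓝[>] (0 : ℝ))).mul hf).congr' ?_ ?_ <;>
  filter_upwards [self_mem_nhdsWithin] with h hh
  · have : h ≠ 0 := ne_of_gt hh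
    field_simp
  · have : h ≠ 0 := ne_of_gt hh
    rw [pow_add]
    field_simp

lemma isBigO_pow_of_le {m n : ℕ} (hmn : m ≤ n) :
    (fun h : ℝ => h ^ n) =O[𝓝[>] (0 : ℝ)] fun h => h ^ m := by
  refine IsBigO.of_bound 1 ?_
  filter_upwards [Ioc_mem_nhdsGT (zero_lt_one' ℝ)] with h hh
  rw [one_mul, norm_pow, norm_pow]
  exact pow_le_pow_of_le_one (norm_nonneg _) (by
    rw [Real.norm_eq_abs, abs_of_pos hh.1]; exact hh.2) hmn

/-- No normalized stencil is exact to order eight on a Robin family, unless `2 β = a_y / a`. -/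
lemma false_of_stencil_isBigO_pow_eight {b P Q : ℝ} (hbQ : 2 * b ≠ Q) {C : ℤ → ℤ → ℝ → ℝ} {δ : ℝ}
    (hδ : 0 < δ) (hC : ∀ᶠ h in 𝓝[>] (0 : ℝ), δ ≤ stencilSum fun k l => |C k l h|)
    {W : ℕ → ℤ → ℤ → ℝ → ℝ}
    (hW : ∀ n < 7, ∀ k ∈ Finset.Icc (-1 : ℤ) 1, ∀ l ∈ Finset.Icc (-1 : ℤ) 0,
      (fun h => W n k l h - (h ^ n * leadPart n k l + h ^ (n + 1) * nextPart b P Q n k l))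
        =O[𝓝[>] (0 : ℝ)] fun h => h ^ (n + 2))
    (hCW : ∀ n < 7, (fun h => stencilSum fun k l => C k l h * W n k l h)
      =O[𝓝[>] (0 : ℝ)] fun h => h ^ 8) : False := by
  -- Normalization bounds the stencil only from below, and it may blow up as `h → 0`. Dividing by
  -- its total size keeps the estimates and gives bounded weights of total size one.
  set σ : ℝ → ℝ := fun h => stencilSum fun k l => |C k l h| with hσ
  set c : ℤ → ℤ → ℝ → ℝ := fun k l h => C k l h / σ h with hc
  have hσinv : (fun h => (σ h)⁻¹) =O[𝓝[>] (0 : ℝ)] fun _ => (1 : ℝ) := by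
    refine IsBigO.of_bound δ⁻¹ ?_
    filter_upwards [hC] with h hh
    rw [norm_inv, Real.norm_eq_abs, abs_of_pos (hδ.trans_le hh), norm_one, mul_one]
    exact inv_anti₀ hδ hh
  have hsum1 : ∀ᶠ h in 𝓝[>] (0 : ℝ), (stencilSum fun k l => |c k l h|) = 1 := by
    filter_upwards [hC] with h hh
    have hpos : 0 < σ h := hδ.trans_le hh
    have : ∀ k l, |c k l h| = (σ h)⁻¹ * |C k l h| := fun k l => by
      rw [hc, abs_div, abs_of_pos hpos]; ring
    simp only [this, stencilSum_mul_left]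
    exact inv_mul_cancel₀ hpos.ne'
  have hcbd : ∀ k ∈ Finset.Icc (-1 : ℤ) 1, ∀ l ∈ Finset.Icc (-1 : ℤ) 0,
      c k l =O[𝓝[>] (0 : ℝ)] fun _ => (1 : ℝ) := by
    intro k hk l hl
    refine IsBigO.of_bound 1 ?_
    filter_upwards [hsum1] with h hh
    rw [norm_one, mul_one, ← hh, stencilSum, Real.norm_eq_abs]
    refine le_trans ?_ (Finset.single_le_sum
      (fun k _ => Finset.sum_nonneg fun l _ => abs_nonneg (c k l h)) hk)
    exact Finset.single_le_sum (fun l _ => abs_nonneg (c k l h)) hl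
  have hcW : ∀ n < 7, (fun h => stencilSum fun k l => c k l h * W n k l h)
      =O[𝓝[>] (0 : ℝ)] fun h => h ^ 8 := by
    intro n hn
    refine (hσinv.mul (hCW n hn)).congr (fun h => ?_) fun h => one_mul _
    rw [← stencilSum_mul_left]
    congr 1; ext k l
    simp only [hc]; ring
  -- After division by `h^n` the pairing is `O(h^(8-n))`, while the expansion of `W` is known only
  -- modulo `h^2`. For `n = 6` both exponents equal two, which is where order seven is used.
  have hboth : ∀ n < 7, (fun h => (stencilSum fun k l => c k l h * leadPart n k l)
      + h * stencilSum fun k l => c k l h * nextPart b P Q n k l)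
      =O[𝓝[>] (0 : ℝ)] fun h => h ^ min 2 (8 - n) := by
    intro n hn
    refine isBigO_of_pow_mul n _ ?_
    have h1 : (fun h => stencilSum fun k l => c k l h * (W n k l h
        - (h ^ n * leadPart n k l + h ^ (n + 1) * nextPart b P Q n k l)))
        =O[𝓝[>] (0 : ℝ)] fun h => h ^ (n + 2) :=
      isBigO_stencilSum fun k hk l hl => by
        simpa using (hcbd k hk l hl).mul (hW n hn k hk l hl)
    refine (((hcW n hn).trans (isBigO_pow_of_le (m := n + min 2 (8 - n)) (by omega))).sub
      (h1.trans (isBigO_pow_of_le (by omega)))).congr_left fun h => ?_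
    rw [← stencilSum_sub]
    simp only [stencilSum_eq]
    ring
  have hnext : ∀ n, (fun h => h * stencilSum fun k l => c k l h * nextPart b P Q n k l)
      =O[𝓝[>] (0 : ℝ)] fun h => h ^ 1 := by
    intro n
    have h1 : (fun h => stencilSum fun k l => c k l h * nextPart b P Q n k l)
        =O[𝓝[>] (0 : ℝ)] fun _ => (1 : ℝ) :=
      isBigO_stencilSum fun k hk l hl => by
        simpa only [mul_comm] using (hcbd k hk l hl).const_mul_left (nextPart b P Q n k l)
    simpa using (isBigO_refl (fun h : ℝ => h) (𝓝[>] (0 : ℝ))).mul h1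
  have hlead : ∀ n < 7, (fun h => stencilSum fun k l => c k l h * leadPart n k l)
      =O[𝓝[>] (0 : ℝ)] fun h => h ^ 1 := fun n hn =>
    (((hboth n hn).trans (isBigO_pow_of_le (by omega))).sub (hnext n)).congr_left fun h => by ring
  obtain ⟨g0, g1, g2, g3, g4, g5, g6⟩ := leadPart_values
  obtain ⟨-, n2, -, -, n6⟩ := nextPart_values b P Q
  -- On the six points `720 L₆ = 2 L₂`, so the leading parts cancel and a factor `h` can be divided
  -- out.
  have hdiff : (fun h => stencilSum fun k l =>
      c k l h * (720 * nextPart b P Q 6 k l - 2 * nextPart b P Q 2 k l))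
      =O[𝓝[>] (0 : ℝ)] fun h => h ^ 1 := by
    refine isBigO_of_pow_mul 1 1 ((((hboth 6 (by norm_num)).const_mul_left 720).sub
      ((hboth 2 (by norm_num)).const_mul_left 2)).congr_left fun h => ?_)
    simp only [stencilSum_eq, g6, g2]
    push_cast
    ring
  have e0 := hlead 0 (by norm_num)
  have e1 := hlead 1 (by norm_num)
  have e2 := hlead 2 (by norm_num)
  have e3 := hlead 3 (by norm_num)
  have e4 := hlead 4 (by norm_num)
  simp only [stencilSum_eq, g0, g1, g2, g3, g4, n2, n6] at e0 e1 e2 e3 e4 hdiff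
  norm_num at e0 e1 e2 e3 e4 hdiff
  -- The odd part at `y = -1` is isolated from degrees 1 and 3; it accounts for the term `5P` in
  -- `hdiff`.
  have hd : (fun h => c 1 (-1) h - c (-1) (-1) h) =O[𝓝[>] (0 : ℝ)] fun h => h :=
    ((e1.const_mul_left (1 / 3)).sub (e3.const_mul_left 2)).congr_left fun h => by ring
  -- Without its odd part, `hdiff` is `(2b - Q)(2A - 19E) / 21`, with `A` the weight at `(0, -1)`
  -- and `E` the sum of those at `(±1, -1)`. Degrees 2 and 4 give `A = 2E` up to `O(h)`, which
  -- leaves a nonzero multiple of `A`. Elimination then makes all six weights `O(h)`, against total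
  -- size one.
  have hA : c 0 (-1) =O[𝓝[>] (0 : ℝ)] fun h => h := by
    have hne : 2 * b - Q ≠ 0 := sub_ne_zero.2 hbQ
    refine ((((hdiff.sub (hd.const_mul_left (5 * P))).const_mul_left
      (- (42 / 15) / (2 * b - Q))).sub (e2.const_mul_left (19 / 15))).add
      (e4.const_mul_left (19 * 12 / 15))).congr_left fun h => ?_
    field_simp
    ring
  have hE : (fun h => c 1 (-1) h + c (-1) (-1) h) =O[𝓝[>] (0 : ℝ)] fun h => h :=
    (((hA.const_mul_left (1 / 2)).add (e2.const_mul_left (1 / 2))).sub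
      (e4.const_mul_left 6)).congr_left fun h => by ring
  have hF : (fun h => c 1 0 h + c (-1) 0 h) =O[𝓝[>] (0 : ℝ)] fun h => h :=
    (hA.add (e2.const_mul_left 2)).congr_left fun h => by ring
  have hK : (fun h => c 1 0 h - c (-1) 0 h) =O[𝓝[>] (0 : ℝ)] fun h => h :=
    (e1.sub hd).congr_left fun h => by ring
  have hB : c 0 0 =O[𝓝[>] (0 : ℝ)] fun h => h :=
    (((e0.sub hA).sub hE).sub hF).congr_left fun h => by ring
  have c1 : c 1 (-1) =O[𝓝[>] (0 : ℝ)] fun h => h :=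
    ((hE.add hd).const_mul_left (1 / 2)).congr_left fun h => by ring
  have c2 : c (-1) (-1) =O[𝓝[>] (0 : ℝ)] fun h => h :=
    ((hE.sub hd).const_mul_left (1 / 2)).congr_left fun h => by ring
  have c3 : c 1 0 =O[𝓝[>] (0 : ℝ)] fun h => h :=
    ((hF.add hK).const_mul_left (1 / 2)).congr_left fun h => by ring
  have c4 : c (-1) 0 =O[𝓝[>] (0 : ℝ)] fun h => h :=
    ((hF.sub hK).const_mul_left (1 / 2)).congr_left fun h => by ring
  have htot : (fun h => stencilSum fun k l => |c k l h|) =O[𝓝[>] (0 : ℝ)] fun h => h := by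
    simp only [stencilSum_eq]
    exact ((c2.abs_left.add c4.abs_left).add (hA.abs_left.add hB.abs_left)).add
      (c1.abs_left.add c3.abs_left)
  have h0 : Tendsto (fun h => stencilSum fun k l => |c k l h|) (𝓝[>] (0 : ℝ)) (𝓝 0) :=
    htot.trans_tendsto (tendsto_id.mono_left nhdsWithin_le_nhds)
  have h1 : Tendsto (fun h => stencilSum fun k l => |c k l h|) (𝓝[>] (0 : ℝ)) (𝓝 1) :=
    tendsto_const_nhds.congr' (hsum1.mono fun h hh => hh.symm)
  exact zero_ne_one (tendsto_nhds_unique h0 h1)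

/-! ### Calculus on the closed rectangle off the interface -/

namespace InterfaceDomain

variable (D : InterfaceDomain)

lemma isOpen_ne_zero : IsOpen {q | D.ψ q ≠ 0} :=
  isOpen_ne_fun D.smooth_ψ.continuous continuous_const

lemma regularSet_eq : D.regularSet = D.box ∩ {q | D.ψ q ≠ 0} := rfl

lemma uniqueDiffOn_box : UniqueDiffOn ℝ D.box :=
  (uniqueDiffOn_Icc D.lt₁₂).prod (uniqueDiffOn_Icc D.lt₃₄)

lemma uniqueDiffOn_regularSet : UniqueDiffOn ℝ D.regularSet :=
  D.uniqueDiffOn_box.inter D.isOpen_ne_zero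

lemma closure_Ω : closure D.Ω = D.box := by
  rw [Ω, closure_prod_eq, closure_Ioo D.lt₁₂.ne, closure_Ioo D.lt₃₄.ne, box]

lemma Ω_subset_box : D.Ω ⊆ D.box := D.closure_Ω ▸ subset_closure

lemma diff_interface_eq : D.Ω \ D.interface = {q | D.ψ q ≠ 0} ∩ D.Ω := by
  ext q
  simp only [interface, Set.mem_sdiff, Set.mem_ofPred_eq, Set.mem_inter_iff]
  tauto

lemma regularSet_subset_closure : D.regularSet ⊆ closure (D.Ω \ D.interface) := by
  rw [diff_interface_eq]
  rintro q ⟨hq, hψ⟩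
  exact D.isOpen_ne_zero.inter_closure ⟨hψ, D.closure_Ω ▸ hq⟩

lemma diff_interface_subset : D.Ω \ D.interface ⊆ D.regularSet := by
  rw [diff_interface_eq]
  exact fun q hq => ⟨D.Ω_subset_box hq.2, hq.1⟩

lemma mem_closure_interior {q : ℝ × ℝ} (hq : q ∈ D.regularSet) :
    q ∈ closure (interior D.regularSet) := by
  refine closure_mono ?_ (D.regularSet_subset_closure hq)
  refine interior_maximal D.diff_interface_subset ?_
  rw [diff_interface_eq]
  exact D.isOpen_ne_zero.inter (isOpen_Ioo.prod isOpen_Ioo)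

/-- The derivative on the closed rectangle in the direction `e`. -/
def dd (e : ℝ × ℝ) (v : ℝ × ℝ → ℝ) (q : ℝ × ℝ) : ℝ := fderivWithin ℝ v D.box q e

lemma dx_eq_dd : D.dx = D.dd (1, 0) := rfl

lemma dy_eq_dd : D.dy = D.dd (0, 1) := rfl

variable {D} {e e' : ℝ × ℝ} {v w : ℝ × ℝ → ℝ} {q : ℝ × ℝ}

/-- The set `{ψ ≠ 0}` is open, so derivatives within the rectangle and within the regular set agree
there. The smoothness hypotheses concern the latter. -/
lemma dd_eq (hq : q ∈ D.regularSet) : D.dd e v q = fderivWithin ℝ v D.regularSet q e := by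
  rw [dd, regularSet_eq, fderivWithin_inter (D.isOpen_ne_zero.mem_nhds hq.2)]

lemma dd_congr (h : Set.EqOn v w D.regularSet) : Set.EqOn (D.dd e v) (D.dd e w) D.regularSet := by
  intro q hq
  rw [dd_eq hq, dd_eq hq, fderivWithin_congr h (h hq)]

lemma iterate_dd_congr (h : Set.EqOn v w D.regularSet) (n : ℕ) :
    Set.EqOn ((D.dd e)^[n] v) ((D.dd e)^[n] w) D.regularSet := by
  induction n generalizing v w with
  | zero => exact h
  | succ n ih => exact ih (dd_congr h)

lemma pd_congr (h : Set.EqOn v w D.regularSet) (m n : ℕ) :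
    Set.EqOn (D.pd m n v) (D.pd m n w) D.regularSet :=
  iterate_dd_congr (iterate_dd_congr h n) m

lemma contDiffOn_dd {k K : WithTop ℕ∞} (hv : ContDiffOn ℝ K v D.regularSet) (hk : k + 1 ≤ K) :
    ContDiffOn ℝ k (D.dd e v) D.regularSet :=
  ((hv.fderivWithin D.uniqueDiffOn_regularSet hk).clm_apply contDiffOn_const).congr
    fun _ hq => dd_eq hq

lemma contDiffOn_iterate_dd {k K : ℕ} (n : ℕ) (hv : ContDiffOn ℝ K v D.regularSet)
    (hk : k + n ≤ K) : ContDiffOn ℝ k ((D.dd e)^[n] v) D.regularSet := by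
  induction n generalizing k with
  | zero => exact hv.of_le (by exact_mod_cast hk)
  | succ n ih =>
    rw [Function.iterate_succ_apply']
    exact contDiffOn_dd (ih (k := k + 1) (by omega)) (by norm_cast)

lemma hasFDerivWithinAt_regular (hv : ContDiffOn ℝ 1 v D.regularSet) (hq : q ∈ D.regularSet) :
    HasFDerivWithinAt v (fderivWithin ℝ v D.box q) D.box q := by
  have h := ((hv.differentiableOn one_ne_zero) q hq).hasFDerivWithinAt
  rw [regularSet_eq, fderivWithin_inter (D.isOpen_ne_zero.mem_nhds hq.2)] at h
  exact (hasFDerivWithinAt_inter (D.isOpen_ne_zero.mem_nhds hq.2)).1 h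

/-- Mixed one-sided derivatives commute up to the boundary because the regular set lies in the
closure of its interior. -/
lemma dd_comm (hv : ContDiffOn ℝ 2 v D.regularSet) :
    Set.EqOn (D.dd e (D.dd e' v)) (D.dd e' (D.dd e v)) D.regularSet := by
  intro q hq
  have hd : DifferentiableWithinAt ℝ (fderivWithin ℝ v D.regularSet) D.regularSet q :=
    ((hv.fderivWithin (m := 1) D.uniqueDiffOn_regularSet (by norm_num)).differentiableOn
      one_ne_zero) q hq
  have key : ∀ e e' : ℝ × ℝ, D.dd e (D.dd e' v) q
      = fderivWithin ℝ (fderivWithin ℝ v D.regularSet) D.regularSet q e e' := by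
    intro e e'
    rw [dd_eq hq, fderivWithin_congr (fun z hz => dd_eq hz) (dd_eq hq),
      fderivWithin_clm_apply (D.uniqueDiffOn_regularSet q hq) hd (differentiableWithinAt_const _)]
    simp
  rw [key, key]
  exact (hv.contDiffWithinAt hq).isSymmSndFDerivWithinAt (by simp)
    D.uniqueDiffOn_regularSet (D.mem_closure_interior hq) hq e e'

lemma iterate_dd_comm {n : ℕ} (hv : ContDiffOn ℝ (n + 1 : ℕ) v D.regularSet) :
    Set.EqOn ((D.dd e)^[n] (D.dd e' v)) (D.dd e' ((D.dd e)^[n] v)) D.regularSet := by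
  induction n generalizing v with
  | zero => exact fun _ _ => rfl
  | succ n ih =>
    rw [Function.iterate_succ_apply, Function.iterate_succ_apply]
    exact (iterate_dd_congr (dd_comm (hv.of_le (by norm_cast; omega))) n).trans
      (ih (contDiffOn_dd hv (by norm_cast)))

lemma pd_dx {m n : ℕ} (hv : ContDiffOn ℝ (n + 1 : ℕ) v D.regularSet) :
    Set.EqOn (D.pd m n (D.dx v)) (D.pd (m + 1) n v) D.regularSet := by
  rw [pd, pd, Function.iterate_succ_apply]
  exact iterate_dd_congr (iterate_dd_comm hv) m

lemma pd_dy (m n : ℕ) (v : ℝ × ℝ → ℝ) : D.pd m n (D.dy v) = D.pd m (n + 1) v := rfl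

lemma dd_add (hv : ContDiffOn ℝ 1 v D.regularSet) (hw : ContDiffOn ℝ 1 w D.regularSet) :
    Set.EqOn (D.dd e (fun z => v z + w z)) (fun z => D.dd e v z + D.dd e w z) D.regularSet := by
  intro q hq
  rw [dd, ((hasFDerivWithinAt_regular hv hq).fun_add (hasFDerivWithinAt_regular hw hq)).fderivWithin
    (D.uniqueDiffOn_box q hq.1)]
  rfl

lemma dd_neg (v : ℝ × ℝ → ℝ) :
    Set.EqOn (D.dd e (fun z => - v z)) (fun z => - D.dd e v z) D.regularSet := by
  intro q hq
  rw [dd, fderivWithin_fun_neg (D.uniqueDiffOn_box q hq.1)]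
  rfl

lemma dd_mul (hv : ContDiffOn ℝ 1 v D.regularSet) (hw : ContDiffOn ℝ 1 w D.regularSet) :
    Set.EqOn (D.dd e (fun z => v z * w z)) (fun z => v z * D.dd e w z + D.dd e v z * w z)
      D.regularSet := by
  intro q hq
  rw [dd, ((hasFDerivWithinAt_regular hv hq).fun_mul (hasFDerivWithinAt_regular hw hq)).fderivWithin
    (D.uniqueDiffOn_box q hq.1)]
  simp [dd, mul_comm]

lemma iterate_dd_add {n : ℕ} (hv : ContDiffOn ℝ n v D.regularSet)
    (hw : ContDiffOn ℝ n w D.regularSet) :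
    Set.EqOn ((D.dd e)^[n] (fun z => v z + w z)) (fun z => (D.dd e)^[n] v z + (D.dd e)^[n] w z)
      D.regularSet := by
  induction n generalizing v w with
  | zero => exact fun _ _ => rfl
  | succ n ih =>
    simp only [Function.iterate_succ_apply]
    exact (iterate_dd_congr (dd_add (hv.of_le (by norm_cast; omega))
      (hw.of_le (by norm_cast; omega))) n).trans
      (ih (contDiffOn_dd hv (by norm_cast)) (contDiffOn_dd hw (by norm_cast)))

lemma iterate_dd_neg (n : ℕ) (v : ℝ × ℝ → ℝ) :
    Set.EqOn ((D.dd e)^[n] (fun z => - v z)) (fun z => - (D.dd e)^[n] v z) D.regularSet := by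
  induction n generalizing v with
  | zero => exact fun _ _ => rfl
  | succ n ih =>
    simp only [Function.iterate_succ_apply]
    exact (iterate_dd_congr (dd_neg v) n).trans (ih _)

lemma pd_add {m n : ℕ} (hv : ContDiffOn ℝ (m + n : ℕ) v D.regularSet)
    (hw : ContDiffOn ℝ (m + n : ℕ) w D.regularSet) :
    Set.EqOn (D.pd m n (fun z => v z + w z)) (fun z => D.pd m n v z + D.pd m n w z)
      D.regularSet :=
  (iterate_dd_congr (iterate_dd_add (hv.of_le (by norm_cast; omega))
    (hw.of_le (by norm_cast; omega))) m).trans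
    (iterate_dd_add (contDiffOn_iterate_dd n hv le_rfl) (contDiffOn_iterate_dd n hw le_rfl))

lemma pd_neg (m n : ℕ) (v : ℝ × ℝ → ℝ) :
    Set.EqOn (D.pd m n (fun z => - v z)) (fun z => - D.pd m n v z) D.regularSet :=
  (iterate_dd_congr (iterate_dd_neg n v) m).trans (iterate_dd_neg m _)

lemma iterate_dd_const_mul {n : ℕ} (c : ℝ) (hv : ContDiffOn ℝ n v D.regularSet) :
    Set.EqOn ((D.dd e)^[n] (fun z => c * v z)) (fun z => c * (D.dd e)^[n] v z) D.regularSet := by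
  induction n generalizing v with
  | zero => exact fun _ _ => rfl
  | succ n ih =>
    simp only [Function.iterate_succ_apply]
    refine (iterate_dd_congr (w := fun z => c * D.dd e v z) ?_ n).trans
      (ih (contDiffOn_dd hv (by norm_cast)))
    intro q hq
    rw [dd, ((hasFDerivWithinAt_regular (hv.of_le (by norm_cast; omega)) hq).const_mul
      c).fderivWithin (D.uniqueDiffOn_box q hq.1)]
    simp [dd]

lemma iterate_dd_sum {ι : Type*} (s : Finset ι) {n : ℕ} {v : ι → ℝ × ℝ → ℝ}
    (hv : ∀ i ∈ s, ContDiffOn ℝ n (v i) D.regularSet) :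
    Set.EqOn ((D.dd e)^[n] (fun z => ∑ i ∈ s, v i z)) (fun z => ∑ i ∈ s, (D.dd e)^[n] (v i) z)
      D.regularSet := by
  classical
  induction s using Finset.induction_on with
  | empty =>
    intro q hq
    have := iterate_dd_const_mul (e := e) (n := n) (0 : ℝ) (v := fun _ => 0) contDiffOn_const hq
    simpa using this
  | insert t s ht ih =>
    simp only [Finset.sum_insert ht]
    have h1 := ih fun i hi => hv i (Finset.mem_insert_of_mem hi)
    have h2 := iterate_dd_add (e := e) (hv t (Finset.mem_insert_self _ _))
      (ContDiffOn.sum fun i hi => hv i (Finset.mem_insert_of_mem hi))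
    intro q hq
    rw [h2 hq]
    simp only
    rw [h1 hq]

lemma iterate_dd_mul {n : ℕ} (hv : ContDiffOn ℝ n v D.regularSet)
    (hw : ContDiffOn ℝ n w D.regularSet) :
    Set.EqOn ((D.dd e)^[n] (fun z => v z * w z))
      (fun z => ∑ i ∈ Finset.range (n + 1),
        (n.choose i : ℝ) * ((D.dd e)^[i] v z * (D.dd e)^[n - i] w z)) D.regularSet := by
  induction n generalizing v w with
  | zero => intro q hq; simp
  | succ n ih =>
    intro q hq
    have hv' : ContDiffOn ℝ n v D.regularSet := hv.of_le (by norm_cast; omega)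
    have hw' : ContDiffOn ℝ n w D.regularSet := hw.of_le (by norm_cast; omega)
    have hdv : ContDiffOn ℝ n (D.dd e v) D.regularSet := contDiffOn_dd hv (by norm_cast)
    have hdw : ContDiffOn ℝ n (D.dd e w) D.regularSet := contDiffOn_dd hw (by norm_cast)
    rw [Function.iterate_succ_apply, iterate_dd_congr (dd_mul (hv.of_le (by norm_cast; omega))
      (hw.of_le (by norm_cast; omega))) n hq, iterate_dd_add (hv'.mul hdw) (hdv.mul hw') hq]
    simp only
    rw [ih hv' hdw hq, ih hdv hw' hq,
      Finset.sum_choose_succ_mul (fun i j => (D.dd e)^[i] v q * (D.dd e)^[j] w q)]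
    congr 1
    refine Finset.sum_congr rfl fun i hi => ?_
    rw [Finset.mem_range] at hi
    rw [show n + 1 - i = n - i + 1 by omega, Function.iterate_succ_apply]

lemma pd_mul {m n : ℕ} (hv : ContDiffOn ℝ (m + n : ℕ) v D.regularSet)
    (hw : ContDiffOn ℝ (m + n : ℕ) w D.regularSet) :
    Set.EqOn (D.pd m n (fun z => v z * w z))
      (fun z => ∑ i ∈ Finset.range (m + 1), ∑ j ∈ Finset.range (n + 1),
        (m.choose i : ℝ) * (n.choose j : ℝ) * (D.pd i j v z * D.pd (m - i) (n - j) w z))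
      D.regularSet := by
  have hdv : ∀ j ∈ Finset.range (n + 1), ContDiffOn ℝ m ((D.dd (0, 1))^[j] v) D.regularSet :=
    fun j hj => contDiffOn_iterate_dd j hv (by rw [Finset.mem_range] at hj; omega)
  have hdw : ∀ j ∈ Finset.range (n + 1), ContDiffOn ℝ m ((D.dd (0, 1))^[n - j] w) D.regularSet :=
    fun j hj => contDiffOn_iterate_dd (n - j) hw (by omega)
  intro q hq
  rw [pd, dx_eq_dd, dy_eq_dd, iterate_dd_congr (iterate_dd_mul (hv.of_le (by norm_cast; omega))
    (hw.of_le (by norm_cast; omega))) m hq, iterate_dd_sum _ (fun j hj =>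
      contDiffOn_const.mul ((hdv j hj).mul (hdw j hj))) hq]
  simp only
  rw [Finset.sum_comm]
  refine Finset.sum_congr rfl fun j hj => ?_
  rw [iterate_dd_const_mul _ ((hdv j hj).mul (hdw j hj)) hq]
  simp only
  rw [iterate_dd_mul (hdv j hj) (hdw j hj) hq, Finset.mul_sum]
  refine Finset.sum_congr rfl fun i hi => ?_
  simp only [pd, dx_eq_dd, dy_eq_dd]
  ring

end InterfaceDomain

namespace InterfaceDomain

variable {D : InterfaceDomain} {e e' : ℝ × ℝ} {v w : ℝ × ℝ → ℝ} {q : ℝ × ℝ}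

/-! ### Taylor expansion at a point -/

/-- Induction on `k` along the ray: the directional derivative is `O(t^(k-1))` by the inductive
hypothesis for `v_x` and `v_y`, and the mean value theorem gains one power. Only rays that stay in
the rectangle are used, so one-sided derivatives suffice. -/
lemma isBigO_of_pd_eq_zero {p : ℝ × ℝ} (hp : p ∈ D.regularSet) (e : ℝ × ℝ)
    (he : ∀ᶠ t in 𝓝[>] (0 : ℝ), p + t • e ∈ D.box) (k : ℕ) {v : ℝ × ℝ → ℝ}
    (hv : ContDiffOn ℝ k v D.regularSet) (h0 : ∀ m n, m + n < k → D.pd m n v p = 0) :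
    (fun t : ℝ => v (p + t • e)) =O[𝓝[>] (0 : ℝ)] fun t => t ^ k := by
  have hcont : Tendsto (fun t : ℝ => p + t • e) (𝓝 (0 : ℝ)) (𝓝 p) := by
    have : Continuous fun t : ℝ => p + t • e := by fun_prop
    simpa using this.tendsto 0
  have hreg : ∀ᶠ t in 𝓝[>] (0 : ℝ), p + t • e ∈ D.regularSet := by
    filter_upwards [he, (hcont.eventually (D.isOpen_ne_zero.mem_nhds hp.2)).filter_mono
      nhdsWithin_le_nhds] with t h1 h2 using ⟨h1, h2⟩
  induction k generalizing v with
  | zero =>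
    have h1 : Tendsto (fun t : ℝ => v (p + t • e)) (𝓝[>] (0 : ℝ)) (𝓝 (v p)) :=
      (hv.continuousOn p hp).tendsto.comp
        (tendsto_nhdsWithin_iff.2 ⟨hcont.mono_left nhdsWithin_le_nhds, hreg⟩)
    simpa using h1.isBigO_one ℝ
  | succ k ih =>
    have hx := ih (v := D.dx v) (contDiffOn_dd hv (by norm_cast)) fun m n hmn => by
      rw [pd_dx (hv.of_le (by norm_cast; omega)) hp]
      exact h0 _ _ (by omega)
    have hy := ih (v := D.dy v) (contDiffOn_dd hv (by norm_cast)) fun m n hmn => by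
      rw [pd_dy]
      exact h0 _ _ (by omega)
    have hsum : (fun t : ℝ => D.dd e v (p + t • e)) =O[𝓝[>] (0 : ℝ)] fun t => t ^ k := by
      refine ((hx.const_mul_left e.1).add (hy.const_mul_left e.2)).congr_left fun t => ?_
      have : e = e.1 • ((1, 0) : ℝ × ℝ) + e.2 • ((0, 1) : ℝ × ℝ) := by ext <;> simp
      simp only [dd, dx, dy]
      conv_rhs => rw [this]
      rw [map_add, map_smul, map_smul]
      simp
    obtain ⟨C, hC⟩ := hsum.bound
    obtain ⟨r, hr, hr'⟩ := mem_nhdsGT_iff_exists_Ioo_subset.1 (hC.and hreg)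
    have hv0 : v p = 0 := h0 0 0 (by omega)
    refine IsBigO.of_bound C ?_
    filter_upwards [Ioo_mem_nhdsGT hr] with t ht
    have ht0 : 0 < t := ht.1
    have hmem : ∀ s ∈ Set.Icc 0 t, p + s • e ∈ D.regularSet := by
      intro s hs
      rcases hs.1.eq_or_lt with rfl | h
      · simpa using hp
      · exact (hr' ⟨h, hs.2.trans_lt ht.2⟩).2
    have hderiv : ∀ s ∈ Set.Icc 0 t, HasDerivWithinAt (fun s : ℝ => v (p + s • e))
        (D.dd e v (p + s • e)) (Set.Icc 0 t) s := by
      intro s hs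
      have h1 := hasFDerivWithinAt_regular (hv.of_le (by norm_cast; omega)) (hmem s hs)
      have h2 : HasDerivWithinAt (fun s : ℝ => p + s • e) e (Set.Icc 0 t) s := by
        simpa using (((hasDerivAt_id s).smul_const e).const_add p).hasDerivWithinAt
      exact h1.comp_hasDerivWithinAt s h2 fun s hs => (hmem s hs).1
    have hcontOn : ContinuousOn (fun s : ℝ => v (p + s • e)) (Set.Icc 0 t) := fun s hs =>
      (hderiv s hs).continuousWithinAt
    -- The bound at the intermediate point `s` is compared with the one at `t`, which needs a
    -- nonnegative constant.
    have hC0 : 0 ≤ C := by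
      have hpos : 0 < ‖t ^ k‖ := norm_pos_iff.2 (pow_pos ht0 k).ne'
      exact nonneg_of_mul_nonneg_left ((norm_nonneg _).trans (hr' ht).1) hpos
    obtain ⟨s, hs, hslope⟩ := exists_hasDerivAt_eq_slope _ _ ht0 hcontOn fun s hs =>
      (hderiv s ⟨hs.1.le, hs.2.le⟩).hasDerivAt (Icc_mem_nhds hs.1 hs.2)
    simp only [zero_smul, add_zero, hv0, sub_zero] at hslope
    rw [eq_div_iff ht0.ne'] at hslope
    rw [← hslope, pow_succ, norm_mul, norm_mul, ← mul_assoc]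
    refine mul_le_mul_of_nonneg_right ?_ (norm_nonneg _)
    refine (hr' ⟨hs.1, hs.2.trans ht.2⟩).1.trans ?_
    rw [norm_pow, norm_pow, Real.norm_of_nonneg ht0.le, Real.norm_of_nonneg hs.1.le]
    exact mul_le_mul_of_nonneg_left (pow_le_pow_left₀ hs.1.le hs.2.le k) hC0

/-- The polynomial with derivatives `J` at `p`, truncated to degrees `< A` in `x` and `< B` in
`y`. -/
def jetPoly (J : ℕ → ℕ → ℝ) (p : ℝ × ℝ) (A B : ℕ) (q : ℝ × ℝ) : ℝ :=
  ∑ i ∈ Finset.range A, ∑ j ∈ Finset.range B,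
    J i j * ((q.1 - p.1) ^ i / (i ! : ℝ) * ((q.2 - p.2) ^ j / (j ! : ℝ)))

lemma contDiff_jetPoly (J : ℕ → ℕ → ℝ) (p : ℝ × ℝ) (A B : ℕ) {n : WithTop ℕ∞} :
    ContDiff ℝ n (jetPoly J p A B) := by
  unfold jetPoly
  fun_prop

lemma hasDerivAt_pow_div_factorial (c x : ℝ) (i : ℕ) :
    HasDerivAt (fun t : ℝ => (t - c) ^ (i + 1) / ((i + 1)! : ℝ)) ((x - c) ^ i / (i ! : ℝ)) x := by
  have h := (((hasDerivAt_id x).sub_const c).pow (i + 1)).div_const ((i + 1)! : ℝ)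
  refine h.congr_deriv ?_
  rw [Nat.factorial_succ]
  push_cast
  have : (i ! : ℝ) ≠ 0 := by positivity
  simp
  field_simp

lemma dd_eq_of_contDiff (hv : ContDiff ℝ 1 v) (hq : q ∈ D.box) : D.dd e v q = fderiv ℝ v q e := by
  rw [dd, (hv.differentiable one_ne_zero q).fderivWithin (D.uniqueDiffOn_box q hq)]

lemma dx_jetPoly (J : ℕ → ℕ → ℝ) (p : ℝ × ℝ) (A B : ℕ) :
    Set.EqOn (D.dx (jetPoly J p (A + 1) B)) (jetPoly (fun i j => J (i + 1) j) p A B)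
      D.regularSet := by
  intro q hq
  have hf := ((contDiff_jetPoly J p (A + 1) B (n := 1)).differentiable one_ne_zero q).hasFDerivAt
  have hline : HasDerivAt (fun t : ℝ => (t, q.2)) ((1 : ℝ), (0 : ℝ)) q.1 :=
    (hasDerivAt_id q.1).prodMk (hasDerivAt_const _ _)
  have h1 := hf.comp_hasDerivAt_of_eq q.1 hline rfl
  have h2 : HasDerivAt (fun t : ℝ => jetPoly J p (A + 1) B (t, q.2))
      (jetPoly (fun i j => J (i + 1) j) p A B q) q.1 := by
    simp only [jetPoly, Finset.sum_range_succ']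
    refine ((HasDerivAt.fun_sum fun i _ => HasDerivAt.fun_sum fun j _ =>
      ((hasDerivAt_pow_div_factorial p.1 q.1 i).mul_const _).const_mul _).add
      (HasDerivAt.fun_sum (A' := fun _ => 0) fun j _ => ?_)).congr_deriv ?_
    · simpa using hasDerivAt_const _ _
    · simp
  rw [dx_eq_dd, dd_eq_of_contDiff (contDiff_jetPoly _ _ _ _) hq.1]
  exact h1.unique h2

lemma dy_jetPoly (J : ℕ → ℕ → ℝ) (p : ℝ × ℝ) (A B : ℕ) :
    Set.EqOn (D.dy (jetPoly J p A (B + 1))) (jetPoly (fun i j => J i (j + 1)) p A B)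
      D.regularSet := by
  intro q hq
  have hf := ((contDiff_jetPoly J p A (B + 1) (n := 1)).differentiable one_ne_zero q).hasFDerivAt
  have hline : HasDerivAt (fun t : ℝ => (q.1, t)) ((0 : ℝ), (1 : ℝ)) q.2 :=
    (hasDerivAt_const _ _).prodMk (hasDerivAt_id q.2)
  have h1 := hf.comp_hasDerivAt_of_eq q.2 hline rfl
  have h2 : HasDerivAt (fun t : ℝ => jetPoly J p A (B + 1) (q.1, t))
      (jetPoly (fun i j => J i (j + 1)) p A B q) q.2 := by
    simp only [jetPoly, Finset.sum_range_succ' _ B]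
    refine (HasDerivAt.fun_sum fun i _ => (HasDerivAt.fun_sum fun j _ =>
      ((hasDerivAt_pow_div_factorial p.2 q.2 j).const_mul _).const_mul _).add
      (g' := 0) ?_).congr_deriv ?_
    · simpa using hasDerivAt_const _ _
    · simp
  rw [dy_eq_dd, dd_eq_of_contDiff (contDiff_jetPoly _ _ _ _) hq.1]
  exact h1.unique h2

lemma pd_jetPoly (J : ℕ → ℕ → ℝ) {p : ℝ × ℝ} (hp : p ∈ D.regularSet) {m n A B : ℕ} (hm : m < A)
    (hn : n < B) : D.pd m n (jetPoly J p A B) p = J m n := by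
  have hy : ∀ (n : ℕ) (J : ℕ → ℕ → ℝ) (B : ℕ), Set.EqOn (D.dy^[n] (jetPoly J p A (B + n)))
      (jetPoly (fun i j => J i (j + n)) p A B) D.regularSet := by
    intro n
    induction n with
    | zero => intro J B q hq; rfl
    | succ n ih =>
      intro J B
      rw [Function.iterate_succ_apply]
      refine (iterate_dd_congr (dy_jetPoly J p A (B + n)) n).trans ((ih _ B).trans ?_)
      simp only [add_assoc]
      exact fun _ _ => rfl
  have hx : ∀ (m : ℕ) (J : ℕ → ℕ → ℝ) (A B : ℕ), Set.EqOn (D.dx^[m] (jetPoly J p (A + m) B))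
      (jetPoly (fun i j => J (i + m) j) p A B) D.regularSet := by
    intro m
    induction m with
    | zero => intro J A B q hq; rfl
    | succ m ih =>
      intro J A B
      rw [Function.iterate_succ_apply]
      refine (iterate_dd_congr (dx_jetPoly J p (A + m) B) m).trans ((ih _ A B).trans ?_)
      simp only [add_assoc]
      exact fun _ _ => rfl
  obtain ⟨A', rfl⟩ := Nat.exists_eq_add_of_lt hm
  obtain ⟨B', rfl⟩ := Nat.exists_eq_add_of_lt hn
  rw [show m + A' + 1 = (A' + 1) + m by ring] at hy ⊢
  rw [show n + B' + 1 = (B' + 1) + n by ring, pd,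
    dx_eq_dd, iterate_dd_congr (hy n J (B' + 1)) m hp]
  exact (hx m _ (A' + 1) (B' + 1) hp).trans (by
    simp [jetPoly, Finset.sum_range_succ'])

end InterfaceDomain

namespace InterfaceDomain

variable {D : InterfaceDomain} {v w : ℝ × ℝ → ℝ} {q : ℝ × ℝ}

lemma jetPoly_eq_taylorSum (J : ℕ → ℕ → ℝ) (p : ℝ × ℝ) (K : ℕ) (x y : ℝ) :
    jetPoly (fun i j => if i + j ≤ K then J i j else 0) p (K + 1) (K + 1) (p + (x, y))
      = taylorSum J K x y := by
  rw [jetPoly, taylorSum, Lam, Finset.sum_filter, Finset.sum_product]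
  refine Finset.sum_congr rfl fun i _ => Finset.sum_congr rfl fun j _ => ?_
  by_cases h : i + j ≤ K
  · simp only [h, if_true, Prod.fst_add, Prod.snd_add, add_sub_cancel_left]
    rw [div_mul_div_comm]
  · simp [h]

lemma isBigO_sub_taylorSum {p : ℝ × ℝ} (hp : p ∈ D.regularSet) (x y : ℝ)
    (he : ∀ᶠ t in 𝓝[>] (0 : ℝ), p + t • (x, y) ∈ D.box) (K : ℕ)
    (hv : ContDiffOn ℝ (K + 1 : ℕ) v D.regularSet) :
    (fun t : ℝ => v (p + t • (x, y)) - taylorSum (fun m n => D.pd m n v p) K (x * t) (y * t))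
      =O[𝓝[>] (0 : ℝ)] fun t => t ^ (K + 1) := by
  set T := jetPoly (fun i j => if i + j ≤ K then D.pd i j v p else 0) p (K + 1) (K + 1) with hT
  have hTc : ∀ k : ℕ, ContDiffOn ℝ k T D.regularSet := fun k => (contDiff_jetPoly _ _ _ _).contDiffOn
  refine (isBigO_of_pd_eq_zero hp (x, y) he (K + 1) (v := fun z => v z + - T z)
    (hv.add (hTc _).neg) fun m n hmn => ?_).congr_left fun t => ?_
  · rw [pd_add (hv.of_le (by norm_cast; omega)) (hTc _).neg hp]
    simp only
    rw [pd_neg _ _ _ hp]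
    simp only
    rw [hT, pd_jetPoly _ hp (by omega) (by omega), if_pos (by omega), add_neg_cancel]
  · rw [← jetPoly_eq_taylorSum _ p, sub_eq_add_neg, hT]
    simp [mul_comm]

/-! ### Consequences of the differential equation and of the boundary condition -/

lemma contDiffOn_divGrad {a u : ℝ × ℝ → ℝ} {k : WithTop ℕ∞}
    (ha : ContDiffOn ℝ (k + 1) a D.regularSet) (hu : ContDiffOn ℝ (k + 1 + 1) u D.regularSet) :
    ContDiffOn ℝ k (D.divGrad a u) D.regularSet :=
  (contDiffOn_dd (ha.mul (contDiffOn_dd hu le_rfl)) le_rfl).add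
    (contDiffOn_dd (ha.mul (contDiffOn_dd hu le_rfl)) le_rfl)

/-- The equation is imposed only inside the rectangle while the base point lies on its side;
continuity carries it to the boundary. -/
lemma eqOn_neg_divGrad {a u f : ℝ × ℝ → ℝ} (ha : ContDiffOn ℝ 1 a D.regularSet)
    (hu : ContDiffOn ℝ 2 u D.regularSet) (hf : ContinuousOn f D.regularSet)
    (h : ∀ q ∈ D.Ω \ D.interface, - D.divGrad a u q = f q) :
    Set.EqOn (fun q => - D.divGrad a u q) f D.regularSet :=
  Set.EqOn.of_subset_closure h
    (contDiffOn_divGrad (k := 0) (by simpa using ha)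
      (by simpa [one_add_one_eq_two] using hu)).continuousOn.neg hf
    D.diff_interface_subset D.regularSet_subset_closure

lemma eqOn_dy_dy {a u f : ℝ × ℝ → ℝ} (hpos : ∀ q ∈ D.regularSet, 0 < a q)
    (ha : ContDiffOn ℝ 1 a D.regularSet) (hu : ContDiffOn ℝ 2 u D.regularSet)
    (h : Set.EqOn (fun q => - D.divGrad a u q) f D.regularSet) :
    Set.EqOn (D.dy (D.dy u)) (fun q => - D.dx (D.dx u) q
      + - ((D.dx a q / a q) * D.dx u q + ((D.dy a q / a q) * D.dy u q + (1 / a q) * f q)))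
      D.regularSet := by
  intro q hq
  have hux : ∀ e, ContDiffOn ℝ 1 (D.dd e u) D.regularSet := fun e =>
    contDiffOn_dd hu (by norm_num)
  have h1 := h hq
  simp only [divGrad, dx_eq_dd, dy_eq_dd] at h1 ⊢
  rw [dd_mul ha (hux _) hq, dd_mul ha (hux _) hq] at h1
  have := hpos q hq
  rw [← h1]
  field_simp
  ring

/-- All derivatives of a solution of the equation are determined by `jet`. -/
lemma pd_eq_jet {a u f : ℝ × ℝ → ℝ} {K : ℕ} (hpos : ∀ q ∈ D.regularSet, 0 < a q)
    (ha : ContDiffOn ℝ (K + 1 : ℕ) a D.regularSet) (hu : ContDiffOn ℝ (K + 2 : ℕ) u D.regularSet)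
    (hf : ContDiffOn ℝ K f D.regularSet)
    (h : Set.EqOn (fun q => - D.divGrad a u q) f D.regularSet) {p : ℝ × ℝ} (hp : p ∈ D.regularSet)
    (n m : ℕ) (hmn : m + n ≤ K + 2) :
    D.pd m n u p = D.jet a p (fun i j => D.pd i j f p) (fun i => D.pd i 0 u p)
      (fun i => D.pd i 1 u p) m n := by
  induction n using Nat.strong_induction_on generalizing m with
  | _ n ih =>
    match n with
    | 0 => rw [jet, jetOf_zero_right]
    | 1 => rw [jet, jetOf_one_right]
    | n + 2 =>
      have hne : ∀ q ∈ D.regularSet, a q ≠ 0 := fun q hq => (hpos q hq).ne'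
      have ha' : ContDiffOn ℝ K a D.regularSet := ha.of_le (by norm_cast; omega)
      have hu1 : ContDiffOn ℝ (K + 1 : ℕ) u D.regularSet := hu.of_le (by norm_cast; omega)
      have hle : ((m + n : ℕ) : WithTop ℕ∞) ≤ (K : ℕ) := by norm_cast; omega
      have hdu : ∀ e, ContDiffOn ℝ (m + n : ℕ) (D.dd e u) D.regularSet := fun e =>
        (contDiffOn_dd hu1 (by norm_cast)).of_le hle
      have hda : ∀ e, ContDiffOn ℝ (m + n : ℕ) (fun q => D.dd e a q / a q) D.regularSet := fun e =>
        ((contDiffOn_dd ha (by norm_cast)).div ha' hne).of_le hle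
      have hia : ContDiffOn ℝ (m + n : ℕ) (fun q => 1 / a q) D.regularSet :=
        (contDiffOn_const.div ha' hne).of_le hle
      have hf' : ContDiffOn ℝ (m + n : ℕ) f D.regularSet := hf.of_le hle
      have hddu : ContDiffOn ℝ (m + n : ℕ) (D.dx (D.dx u)) D.regularSet :=
        (contDiffOn_dd (contDiffOn_dd hu (k := (K + 1 : ℕ)) (by norm_cast)) (by norm_cast)).of_le hle
      have hstart : D.pd m (n + 2) u p = D.pd m n (D.dy (D.dy u)) p := rfl
      have hux : ContDiffOn ℝ (m + n : ℕ) (D.dx u) D.regularSet := hdu (1, 0)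
      have huy : ContDiffOn ℝ (m + n : ℕ) (D.dy u) D.regularSet := hdu (0, 1)
      have hax : ContDiffOn ℝ (m + n : ℕ) (fun q => D.dx a q / a q) D.regularSet := hda (1, 0)
      have hay : ContDiffOn ℝ (m + n : ℕ) (fun q => D.dy a q / a q) D.regularSet := hda (0, 1)
      have hp1 := hax.mul hux
      have hp2 := hay.mul huy
      have hp3 := hia.mul hf'
      rw [hstart, pd_congr (eqOn_dy_dy hpos (ha.of_le (by norm_cast; omega))
        (hu.of_le (by norm_cast; omega)) h) m n hp, pd_add hddu.neg (hp1.add (hp2.add hp3)).neg hp]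
      simp only
      rw [pd_neg _ _ _ hp, pd_neg _ _ _ hp]
      simp only
      rw [pd_add hp1 (hp2.add hp3) hp]
      simp only
      rw [pd_add hp2 hp3 hp]
      rw [pd_mul hax hux hp]
      simp only
      rw [pd_mul hay huy hp, pd_mul hia hf' hp]
      simp only
      have hxx : D.pd m n (D.dx (D.dx u)) p = D.pd (m + 2) n u p := by
        rw [pd_dx (v := D.dx u)
          (contDiffOn_dd hu (by norm_cast; omega)) hp, pd_dx (hu.of_le (by norm_cast; omega)) hp]
      rw [hxx, ih n (by omega) (m + 2) (by omega)]
      conv_rhs => rw [jet, jetOf]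
      rw [← Finset.sum_add_distrib, ← Finset.sum_add_distrib, ← sub_eq_add_neg]
      congr 1
      refine Finset.sum_congr rfl fun i hi => ?_
      rw [← Finset.sum_add_distrib, ← Finset.sum_add_distrib]
      refine Finset.sum_congr rfl fun j hj => ?_
      rw [Finset.mem_range] at hi hj
      have h1 : D.pd (m - i) (n - j) (D.dx u) p = D.pd (m - i + 1) (n - j) u p :=
        pd_dx (hu.of_le (by norm_cast; omega)) hp
      have h2 : D.pd (m - i) (n - j) (D.dy u) p = D.pd (m - i) (n - j + 1) u p := rfl
      rw [h1, h2, ih _ (by omega) _ (by omega), ih _ (by omega) _ (by omega)]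
      simp only [jet]
      ring

lemma isOpen_regularTop : IsOpen D.regularTop := by
  have : D.regularTop = Set.Ioo D.l₁ D.l₂ ∩ (fun x => (x, D.l₄)) ⁻¹' {q | D.ψ q ≠ 0} := rfl
  rw [this]
  exact isOpen_Ioo.inter (D.isOpen_ne_zero.preimage (by fun_prop))

lemma mem_regularSet_of_mem_regularTop {x : ℝ} (hx : x ∈ D.regularTop) :
    (x, D.l₄) ∈ D.regularSet :=
  ⟨⟨⟨hx.1.1.le, hx.1.2.le⟩, ⟨D.lt₃₄.le, le_rfl⟩⟩, hx.2⟩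

lemma hasDerivAt_top (hv : ContDiffOn ℝ 1 v D.regularSet) {x : ℝ} (hx : x ∈ D.regularTop) :
    HasDerivAt (fun t => v (t, D.l₄)) (D.dx v (x, D.l₄)) x := by
  have h1 := hasFDerivWithinAt_regular hv (mem_regularSet_of_mem_regularTop hx)
  have h2 : HasDerivWithinAt (fun t : ℝ => (t, D.l₄)) ((1 : ℝ), (0 : ℝ)) (Set.Icc D.l₁ D.l₂) x :=
    ((hasDerivAt_id x).prodMk (hasDerivAt_const _ _)).hasDerivWithinAt
  have hmaps : Set.MapsTo (fun t : ℝ => (t, D.l₄)) (Set.Icc D.l₁ D.l₂) D.box :=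
    fun t ht => ⟨ht, D.lt₃₄.le, le_rfl⟩
  exact (h1.comp_hasDerivWithinAt x h2 hmaps).hasDerivAt (Icc_mem_nhds hx.1.1 hx.1.2)

lemma iteratedDeriv_top {n : ℕ} (hv : ContDiffOn ℝ n v D.regularSet) {x : ℝ}
    (hx : x ∈ D.regularTop) :
    iteratedDeriv n (fun t => v (t, D.l₄)) x = D.pd n 0 v (x, D.l₄) := by
  induction n generalizing v with
  | zero => simp [pd]
  | succ n ih =>
    rw [iteratedDeriv_succ']
    have hev : deriv (fun t => v (t, D.l₄)) =ᶠ[𝓝 x] fun t => D.dx v (t, D.l₄) := by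
      filter_upwards [isOpen_regularTop.mem_nhds hx] with t ht
      exact (hasDerivAt_top (hv.of_le (by norm_cast; omega)) ht).deriv
    rw [hev.iteratedDeriv_eq, ih (v := D.dx v) (contDiffOn_dd hv (by norm_cast))]
    rfl

lemma contDiffOn_top {k : WithTop ℕ∞} (hv : ContDiffOn ℝ k v D.regularSet) :
    ContDiffOn ℝ k (fun t => v (t, D.l₄)) D.regularTop :=
  hv.comp (f := fun t : ℝ => (t, D.l₄)) (by fun_prop)
    fun _ ht => mem_regularSet_of_mem_regularTop ht

lemma iteratedDeriv_robin {u : ℝ × ℝ → ℝ} {β g : ℝ → ℝ} {n : ℕ}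
    (hu : ContDiffOn ℝ (n + 1 : ℕ) u D.regularSet) (hβ : ContDiffOn ℝ n β D.regularTop)
    (h : ∀ x ∈ D.regularTop, D.dy u (x, D.l₄) + β x * u (x, D.l₄) = g x) {x : ℝ}
    (hx : x ∈ D.regularTop) :
    iteratedDeriv n g x = D.pd n 1 u (x, D.l₄) + ∑ i ∈ Finset.range (n + 1),
      (n.choose i : ℝ) * iteratedDeriv (n - i) β x * D.pd i 0 u (x, D.l₄) := by
  have hu' : ContDiffOn ℝ n u D.regularSet := hu.of_le (by norm_cast; omega)
  have hdu : ContDiffOn ℝ n (D.dy u) D.regularSet := contDiffOn_dd hu (by norm_cast)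
  have hmem := isOpen_regularTop.mem_nhds hx
  have hev : g =ᶠ[𝓝 x] fun t => D.dy u (t, D.l₄) + u (t, D.l₄) * β t := by
    filter_upwards [hmem] with t ht
    rw [← h t ht]; ring
  have h1 := (contDiffOn_top hdu).contDiffAt hmem
  have h2 := (contDiffOn_top hu').contDiffAt hmem
  have h3 := hβ.contDiffAt hmem
  rw [hev.iteratedDeriv_eq, iteratedDeriv_fun_add h1 (h2.mul h3), iteratedDeriv_top hdu hx,
    iteratedDeriv_fun_mul h2 h3]
  congr 1
  refine Finset.sum_congr rfl fun i hi => ?_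
  rw [Finset.mem_range] at hi
  rw [iteratedDeriv_top (hu'.of_le (by norm_cast; omega)) hx]
  ring

end InterfaceDomain

/-- By linearity the jet with data `F` and zero `v`, `w` vanishes. At the lowest order not yet
treated, `F m n` enters the entry `(m, n + 2)` with factor `R 0 0 ≠ 0`, which gives an induction on
`m + n`. -/
lemma eq_zero_of_jetOf_eq {P Q R F : ℕ → ℕ → ℝ} {v w : ℕ → ℝ} {K : ℕ} (hR : R 0 0 ≠ 0)
    (h : ∀ m n, m + n ≤ K + 2 →
      jetOf P Q R F v w m n = jetOf P Q R (fun _ _ => 0) v w m n) (m n : ℕ) (hmn : m + n ≤ K) :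
    F m n = 0 := by
  have hE : ∀ m n, m + n ≤ K + 2 → jetOf P Q R F (fun _ => 0) (fun _ => 0) m n = 0 := by
    intro m n hmn
    have h1 := jetOf_add (P := P) (Q := Q) (R := R) (F := F) (F' := fun _ _ => 0)
      (v := fun _ => 0) (v' := v) (w := fun _ => 0) (w' := w) m n
    simp only [add_zero, zero_add] at h1
    have h2 := h m n hmn
    linarith
  induction hs : m + n using Nat.strong_induction_on generalizing m n with
  | _ s ih =>
    have h1 := jetOf_succ_of_vanishing (P := P) (Q := Q) (R := R) (F := F) (v := fun _ => 0)
      (w := fun _ => 0) m n (fun i j hij => hE i j (by omega))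
      (fun i j hij => ih (i + j) (by omega) i j (by omega) rfl)
    rw [hE _ _ (by omega), hE _ _ (by omega), hE _ _ (by omega), hE _ _ (by omega)] at h1
    simpa [hR] using h1

/-! ### Consistency of the scheme, test solutions and optimality. -/

namespace InterfaceDomain

variable {D : InterfaceDomain} {a : ℝ × ℝ → ℝ} {β : ℝ → ℝ} {x₀ : ℝ}

lemma eventually_mem_box (hx₀ : x₀ ∈ Set.Ioo D.l₁ D.l₂) (x : ℝ) {y : ℝ} (hy : y ≤ 0) :
    ∀ᶠ t in 𝓝[>] (0 : ℝ), (x₀, D.l₄) + t • (x, y) ∈ D.box := by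
  have h1 : Tendsto (fun t : ℝ => x₀ + t * x) (𝓝[>] 0) (𝓝 x₀) := by
    have : Continuous fun t : ℝ => x₀ + t * x := by fun_prop
    simpa using (this.tendsto 0).mono_left nhdsWithin_le_nhds
  have h2 : Tendsto (fun t : ℝ => D.l₄ + t * y) (𝓝[>] 0) (𝓝 D.l₄) := by
    have : Continuous fun t : ℝ => D.l₄ + t * y := by fun_prop
    simpa using (this.tendsto 0).mono_left nhdsWithin_le_nhds
  filter_upwards [h1.eventually (Icc_mem_nhds hx₀.1 hx₀.2), h2.eventually (Ioi_mem_nhds D.lt₃₄),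
    self_mem_nhdsWithin] with t ht1 ht2 ht3
  refine ⟨by simpa using ht1, ?_, ?_⟩
  · simpa using (show D.l₃ < D.l₄ + t * y from ht2).le
  · simpa using mul_nonpos_of_nonneg_of_nonpos (le_of_lt ht3) hy

lemma isBigO_sub_taylorSum_stencil (hx₀ : x₀ ∈ Set.Ioo D.l₁ D.l₂) (hreg : D.ψ (x₀, D.l₄) ≠ 0)
    {v : ℝ × ℝ → ℝ} (K : ℕ) (hv : ContDiffOn ℝ (K + 1 : ℕ) v D.regularSet) (k : ℤ) {l : ℤ}
    (hl : l ∈ Finset.Icc (-1 : ℤ) 0) :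
    (fun t : ℝ => v (x₀ + k * t, D.l₄ + l * t)
      - taylorSum (fun m n => D.pd m n v (x₀, D.l₄)) K (k * t) (l * t))
      =O[𝓝[>] (0 : ℝ)] fun t => t ^ (K + 1) := by
  have hl0 : (l : ℝ) ≤ 0 := by exact_mod_cast (Finset.mem_Icc.1 hl).2
  refine (isBigO_sub_taylorSum (mem_regularSet_of_mem_regularTop ⟨hx₀, hreg⟩) k l
    (eventually_mem_box hx₀ k hl0) K hv).congr_left fun t => ?_
  congr 2
  ext <;> simp [mul_comm]

/-- Eliminating `w` by the Robin condition and exchanging the two sums regroups the expansion by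
boundary derivatives `v n`; each is multiplied by exactly the polynomial of the linear system. -/
lemma taylorSum_jet_robin (p : ℝ × ℝ) (F : ℕ → ℕ → ℝ) (v g b : ℕ → ℝ) (x y : ℝ) :
    taylorSum (D.jet a p F v fun m => g m - ∑ n ∈ Finset.range (m + 1),
        (m.choose n : ℝ) * b (m - n) * v n) 6 x y
      = ∑ n ∈ Finset.range 7, v n * taylorSum (D.robinJet a p b n) 6 x y
        + (∑ q ∈ Lam 4, F q.1 q.2 * D.QH a p 5 q.1 q.2 x y
          + ∑ n ∈ Finset.range 6, g n * D.GH a p 5 n 1 x y) := by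
  have h1 : ∀ n ∈ Finset.range 7, v n * taylorSum (D.robinJet a p b n) 6 x y
      = v n * D.GH a p 5 n 0 x y
        - ∑ m ∈ Finset.range 6, (m.choose n : ℝ) * b (m - n) * v n * D.GH a p 5 m 1 x y := by
    intro n hn
    rw [Finset.mem_range] at hn
    rw [robinJet, D.taylorSum_jet]
    simp [hn, mul_add, Finset.mul_sum, sub_eq_add_neg]
    exact Finset.sum_congr rfl fun m _ => by ring
  have h2 : ∀ m ∈ Finset.range 6,
      ∑ n ∈ Finset.range 7, (m.choose n : ℝ) * b (m - n) * v n * D.GH a p 5 m 1 x y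
      = (∑ n ∈ Finset.range (m + 1), (m.choose n : ℝ) * b (m - n) * v n)
        * D.GH a p 5 m 1 x y := by
    intro m hm
    rw [Finset.mem_range] at hm
    rw [Finset.sum_mul]
    refine (Finset.sum_subset (Finset.range_subset_range.2 (by omega)) fun n hn hn' => ?_).symm
    rw [Finset.mem_range] at hn'
    rw [Nat.choose_eq_zero_of_lt (by omega)]
    simp
  rw [Finset.sum_congr rfl h1, Finset.sum_sub_distrib, Finset.sum_comm, Finset.sum_congr rfl h2,
    D.taylorSum_jet]
  simp only [sub_mul, Finset.sum_sub_distrib]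
  ring

lemma IsSolution.mono {ku kf kg ku' kf' kg' : WithTop ℕ∞} {u f : ℝ × ℝ → ℝ} {g : ℝ → ℝ}
    (h : D.IsSolution a β ku kf kg u f g) (hu : ku' ≤ ku) (hf : kf' ≤ kf) (hg : kg' ≤ kg) :
    D.IsSolution a β ku' kf' kg' u f g :=
  ⟨h.contDiff_u.of_le hu, h.contDiff_f.of_le hf, h.contDiff_g.of_le hg, h.pde, h.robin⟩

lemma solvesSystem_iff (c : ℤ → ℤ → ℕ → ℝ) :
    SolvesSystem D x₀ a β c ↔ ∀ n < 7, (fun h : ℝ => stencilSum fun k l => polyCoeff c k l h *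
      taylorSum (D.robinJet a (x₀, D.l₄) (fun i => iteratedDeriv i β x₀) n) 6 (k * h) (l * h))
        =O[𝓝[>] (0 : ℝ)] fun h => h ^ 7 := by
  simp only [SolvesSystem, Finset.mem_range]
  refine forall₂_congr fun n hn => ?_
  simp only [D.taylorSum_robinJet a _ _ hn]

lemma exists_solvesSystem : ∃ c, SolvesSystem D x₀ a β c ∧ IsNontrivial c := by
  obtain ⟨c, hc, hc'⟩ := exists_stencil_of_isRobinFamily
    (D.isRobinFamily_robinJet a (x₀, D.l₄) fun i => iteratedDeriv i β x₀)
  exact ⟨c, (solvesSystem_iff c).2 hc', hc⟩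

lemma polyCoeff_isBigO (c : ℤ → ℤ → ℕ → ℝ) (k l : ℤ) :
    polyCoeff c k l =O[𝓝[>] (0 : ℝ)] fun _ => (1 : ℝ) := by
  have hcont : Continuous (polyCoeff c k l) := by unfold polyCoeff; fun_prop
  exact ((hcont.tendsto 0).mono_left nhdsWithin_le_nhds).isBigO_one ℝ

/-- The `f` and `g` terms of the expansion cancel identically against the right-hand side of the
scheme. What remains is the Taylor remainder of `u` and a combination of the equations of the system
with constant weights `u^{(n,0)}`. -/
lemma isConsistent_robinScheme (hx₀ : x₀ ∈ Set.Ioo D.l₁ D.l₂) (hreg : D.ψ (x₀, D.l₄) ≠ 0)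
    (hab : D.IsCoefficients 6 5 a β) {c : ℤ → ℤ → ℕ → ℝ} (hc : SolvesSystem D x₀ a β c) :
    (robinScheme D x₀ a c).IsConsistent D x₀ a β 7 5 5 6 := by
  intro u f g hs
  have htop : x₀ ∈ D.regularTop := ⟨hx₀, hreg⟩
  have hp := mem_regularSet_of_mem_regularTop htop
  set p := (x₀, D.l₄) with hpdef
  set b : ℕ → ℝ := fun i => iteratedDeriv i β x₀ with hb
  have hu : ContDiffOn ℝ (7 : ℕ) u D.regularSet := hs.contDiff_u
  have hf : ContDiffOn ℝ (5 : ℕ) f D.regularSet := hs.contDiff_f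
  have ha : ContDiffOn ℝ (6 : ℕ) a D.regularSet := hab.contDiff_a
  have hβ : ContDiffOn ℝ (5 : ℕ) β D.regularTop := hab.contDiff_β
  have hpde := eqOn_neg_divGrad (ha.of_le (by norm_num)) (hu.of_le (by norm_num)) hf.continuousOn
    hs.pde
  have htaylor : ∀ x y, taylorSum (fun m n => D.pd m n u p) 6 x y
      = ∑ n ∈ Finset.range 7, D.pd n 0 u p * taylorSum (D.robinJet a p b n) 6 x y
        + (∑ q ∈ Lam 4, D.pd q.1 q.2 f p * D.QH a p 5 q.1 q.2 x y
          + ∑ n ∈ Finset.range 6, iteratedDeriv n g x₀ * D.GH a p 5 n 1 x y) := by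
    intro x y
    rw [← taylorSum_jet_robin p (fun i j => D.pd i j f p) (fun i => D.pd i 0 u p)
      (fun n => iteratedDeriv n g x₀) b x y]
    refine Finset.sum_congr rfl fun q hq => ?_
    rw [mem_Lam] at hq
    congr 1
    simp only
    rw [pd_eq_jet (K := 5) hab.pos ha hu hf hpde hp q.2 q.1 (by omega)]
    refine jetOf_congr _ _ (fun _ _ _ => rfl) (fun _ _ => rfl) fun i hi => ?_
    rw [iteratedDeriv_robin (hu.of_le (by norm_cast; omega)) (hβ.of_le (by norm_cast; omega))
      hs.robin htop, add_sub_cancel_right]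
  have hrem : (fun h : ℝ => stencilSum fun k l => polyCoeff c k l h *
      (u (x₀ + k * h, D.l₄ + l * h) - taylorSum (fun m n => D.pd m n u p) 6 (k * h) (l * h)))
      =O[𝓝[>] (0 : ℝ)] fun h => h ^ 7 :=
    isBigO_stencilSum fun k hk l hl => by
      simpa using (polyCoeff_isBigO c k l).mul
        (isBigO_sub_taylorSum_stencil hx₀ hreg 6 hu k hl)
  have hsys : (fun h : ℝ => ∑ n ∈ Finset.range 7, D.pd n 0 u p * stencilSum fun k l =>
      polyCoeff c k l h * taylorSum (D.robinJet a p b n) 6 (k * h) (l * h))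
      =O[𝓝[>] (0 : ℝ)] fun h => h ^ 7 :=
    IsBigO.fun_sum fun n hn =>
      ((solvesSystem_iff c).1 hc n (Finset.mem_range.1 hn)).const_mul_left _
  refine (hrem.add hsys).congr_left fun h => ?_
  simp only [SixPointScheme.residual, robinScheme, htaylor, ← hpdef, ← stencilSum_mul_left,
    ← stencilSum_sum, ← stencilSum_add, ← stencilSum_sub]
  congr 1
  ext k l
  simp only [mul_sub, mul_add, Finset.mul_sum, mul_left_comm (polyCoeff c k l h)]
  ring

lemma isNormalized_robinScheme {c : ℤ → ℤ → ℕ → ℝ} (hc : IsNontrivial c) :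
    (robinScheme D x₀ a c).IsNormalized := by
  obtain ⟨k, hk, l, hl, hkl⟩ := hc
  have hcont : Continuous fun h => |polyCoeff c k l h| := by unfold polyCoeff; fun_prop
  have h0 : |polyCoeff c k l 0| = |c k l 0| := by
    simp [polyCoeff, Finset.sum_range_succ']
  have hpos : 0 < |c k l 0| := abs_pos.2 hkl
  refine ⟨|c k l 0| / 2, by positivity, ?_⟩
  have hev : ∀ᶠ h in 𝓝 (0 : ℝ), |c k l 0| / 2 < |polyCoeff c k l h| :=
    (hcont.tendsto 0).eventually (lt_mem_nhds (by rw [h0]; linarith))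
  filter_upwards [nhdsWithin_le_nhds hev] with h hh
  refine hh.le.trans ((Finset.single_le_sum (fun l _ => abs_nonneg (polyCoeff c k l h)) hl).trans ?_)
  exact Finset.single_le_sum
    (f := fun k => ∑ l ∈ Finset.Icc (-1 : ℤ) 0, |polyCoeff c k l h|)
    (fun k _ => Finset.sum_nonneg fun l _ => abs_nonneg (polyCoeff c k l h)) hk

/-- For smooth coefficients there are smooth solutions whose data `f`, `g` vanish at the base point
to any prescribed order, with the jets `robinJet`. -/
lemma exists_solution_with_robinJet (hx₀ : x₀ ∈ Set.Ioo D.l₁ D.l₂) (hreg : D.ψ (x₀, D.l₄) ≠ 0)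
    (hab : D.IsCoefficients ∞ ∞ a β) (n N : ℕ) :
    ∃ u f g, D.IsSolution a β ∞ ∞ ∞ u f g ∧
      (∀ i j, i + j ≤ N + 2 → D.pd i j u (x₀, D.l₄)
        = D.robinJet a (x₀, D.l₄) (fun i => iteratedDeriv i β x₀) n i j) ∧
      (∀ i j, i + j ≤ N → D.pd i j f (x₀, D.l₄) = 0) ∧
      ∀ i ≤ N, iteratedDeriv i g x₀ = 0 := by
  have htop : x₀ ∈ D.regularTop := ⟨hx₀, hreg⟩
  have hp := mem_regularSet_of_mem_regularTop htop
  set p := (x₀, D.l₄) with hpdef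
  set b : ℕ → ℝ := fun i => iteratedDeriv i β x₀ with hb
  set u := jetPoly (D.robinJet a p b n) p (N + 3) (N + 3) with hudef
  have hu : ∀ k, ContDiffOn ℝ k u D.regularSet := fun k => (contDiff_jetPoly _ _ _ _).contDiffOn
  have hf : ContDiffOn ℝ ∞ (fun q => - D.divGrad a u q) D.regularSet :=
    (contDiffOn_divGrad (k := ∞) hab.contDiff_a (hu _)).neg
  have hg : ContDiffOn ℝ ∞ (fun x => D.dy u (x, D.l₄) + β x * u (x, D.l₄)) D.regularTop :=
    (contDiffOn_top (contDiffOn_dd (hu (∞ + 1)) le_rfl)).add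
      (hab.contDiff_β.mul (contDiffOn_top (hu ∞)))
  have hjet : ∀ i j, i + j ≤ N + 2 → D.pd i j u p = D.robinJet a p b n i j := fun i j hij =>
    pd_jetPoly _ hp (by omega) (by omega)
  have hle : ∀ k : ℕ, (k : WithTop ℕ∞) ≤ ∞ := fun k => by exact_mod_cast le_top
  refine ⟨u, _, _, ⟨hu _, hf, hg, fun _ _ => rfl, fun _ _ => rfl⟩, hjet, ?_, ?_⟩
  -- The polynomial `u` solves the equation with its own `f`, yet its jet at the base point is the
  -- one generated by zero source, so `f` vanishes there to order `N`.
  · refine eq_zero_of_jetOf_eq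
      (P := fun i j => D.pd i j (fun q => D.dx a q / a q) p)
      (Q := fun i j => D.pd i j (fun q => D.dy a q / a q) p)
      (R := fun i j => D.pd i j (fun q => 1 / a q) p)
      (v := fun i => if i = n then 1 else 0) (w := fun m => - ((m.choose n : ℝ) * b (m - n)))
      (one_div_ne_zero (hab.pos p hp).ne') fun i j hij => ?_
    refine Eq.trans ?_ (hjet i j hij)
    rw [pd_eq_jet (K := N) hab.pos (hab.contDiff_a.of_le (hle _)) (hu _) (hf.of_le (hle _))
      (fun _ _ => rfl) hp j i hij]
    refine jetOf_congr _ _ (fun _ _ _ => rfl) (fun m hm => ?_) fun m hm => ?_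
    · rw [hjet m 0 (by omega), robinJet, jet, jetOf_zero_right]
    · rw [hjet m 1 (by omega), robinJet, jet, jetOf_one_right]
  · intro i hi
    rw [iteratedDeriv_robin (hu _) (hab.contDiff_β.of_le (hle _)) (fun _ _ => rfl) htop,
      hjet i 1 (by omega)]
    have hsum : ∑ m ∈ Finset.range (i + 1), (i.choose m : ℝ) * iteratedDeriv (i - m) β x₀
        * D.pd m 0 u (x₀, D.l₄) = ∑ m ∈ Finset.range (i + 1),
          (i.choose m : ℝ) * b (i - m) * (if m = n then 1 else 0) := by
      refine Finset.sum_congr rfl fun m hm => ?_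
      rw [Finset.mem_range] at hm
      rw [← hpdef, hjet m 0 (by omega), robinJet, jet, jetOf_zero_right]
    rw [hsum, robinJet, jet, jetOf_one_right]
    simp only [mul_ite, mul_one, mul_zero, Finset.sum_ite_eq', Finset.mem_range]
    split_ifs with h
    · ring
    · rw [Nat.choose_eq_zero_of_lt (by omega)]; simp

lemma le_six_of_hasAccuracyOrder (hx₀ : x₀ ∈ Set.Ioo D.l₁ D.l₂) (hreg : D.ψ (x₀, D.l₄) ≠ 0)
    (hab : D.IsCoefficients ∞ ∞ a β) (hne : 2 * a (x₀, D.l₄) * β x₀ ≠ D.dy a (x₀, D.l₄))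
    {S : SixPointScheme} {P : ℕ} (hS : S.HasAccuracyOrder D x₀ a β ∞ ∞ ∞ P) : P ≤ 6 := by
  by_contra hP
  have hp := mem_regularSet_of_mem_regularTop (D := D) (x := x₀) ⟨hx₀, hreg⟩
  have hapos := hab.pos _ hp
  obtain ⟨⟨δ, hδ, hnorm⟩, hcons⟩ := hS
  -- Large enough to kill every datum on the right-hand side of `S` and to fix the jets through
  -- degree `n + 1 ≤ 7`.
  set N := S.ordF + S.ordG + 8 with hN
  choose u f g hsol hu hf hg using fun n =>
    exists_solution_with_robinJet (N := N) hx₀ hreg hab n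
  have hfam := D.isRobinFamily_robinJet a (x₀, D.l₄) fun i => iteratedDeriv i β x₀
  simp only [iteratedDeriv_zero] at hfam
  refine false_of_stencil_isBigO_pow_eight (b := β x₀) (P := D.dx a (x₀, D.l₄) / a (x₀, D.l₄))
    (Q := D.dy a (x₀, D.l₄) / a (x₀, D.l₄)) ?_ hδ hnorm
    (W := fun n k l h => u n (x₀ + k * h, D.l₄ + l * h)) ?_ ?_
  · rw [ne_eq, eq_div_iff hapos.ne']
    intro h
    exact hne (by rw [← h]; ring)
  · intro n hn k _ l hl
    refine (isBigO_sub_taylorSum_stencil hx₀ hreg (n + 1) ((hsol n).contDiff_u.of_le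
      (by exact_mod_cast le_top)) k hl).congr_left fun h => ?_
    congr 1
    rw [taylorSum_mul, Finset.sum_range_succ, Finset.sum_range_succ, Finset.sum_eq_zero, zero_add]
    · rw [leadPart, nextPart]
      congr 2
      · exact homPart_congr (fun i j hij => (hu n i j (by omega)).trans (hfam.lead n i j hij)) _ _
      · exact homPart_congr (fun i j hij => (hu n i j (by omega)).trans (hfam.next n i j hij)) _ _
    · intro d hd
      rw [Finset.mem_range] at hd
      rw [homPart_eq_zero (fun i j hij => (hu n i j (by omega)).trans
        (hfam.low n i j (by omega))), mul_zero]
  · intro n _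
    refine ((hcons _ _ _ (hsol n)).trans (isBigO_pow_of_le (by omega))).congr_left fun h => ?_
    rw [SixPointScheme.residual, Finset.sum_eq_zero, Finset.sum_eq_zero, add_zero, sub_zero]
    · intro i hi
      rw [Finset.mem_range] at hi
      rw [hg n i (by omega), zero_mul]
    · intro q hq
      rw [mem_Lam] at hq
      rw [hf n _ _ (by omega), zero_mul]

lemma exists_hasAccuracyOrder_six (hx₀ : x₀ ∈ Set.Ioo D.l₁ D.l₂) (hreg : D.ψ (x₀, D.l₄) ≠ 0)
    (hab : D.IsCoefficients ∞ ∞ a β) :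
    ∃ S : SixPointScheme, S.HasAccuracyOrder D x₀ a β ∞ ∞ ∞ 6 := by
  have hle : ∀ k : ℕ, (k : WithTop ℕ∞) ≤ ∞ := fun k => by exact_mod_cast le_top
  obtain ⟨c, hc, hc'⟩ := exists_solvesSystem (D := D) (x₀ := x₀) (a := a) (β := β)
  exact ⟨robinScheme D x₀ a c, isNormalized_robinScheme hc', fun u f g hs =>
    isConsistent_robinScheme hx₀ hreg
      ⟨hab.pos, hab.contDiff_a.of_le (hle 6), hab.contDiff_β.of_le (hle 5)⟩ hc u f g
      (hs.mono (hle 7) (hle 5) (hle 5))⟩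

end InterfaceDomain

end

theorem theorem2p4 (D : InterfaceDomain) (x₀ : ℝ)
    (hx₀ : x₀ ∈ Set.Ioo D.l₁ D.l₂) (hreg : D.ψ (x₀, D.l₄) ≠ 0) :
    -- sixth order of accuracy, and solvability of the system
    (∀ (a : ℝ × ℝ → ℝ) (β : ℝ → ℝ), D.IsCoefficients 6 5 a β →
      (∃ c, SolvesSystem D x₀ a β c ∧ IsNontrivial c) ∧
      (∀ c, SolvesSystem D x₀ a β c →
        (robinScheme D x₀ a c).IsConsistent D x₀ a β 7 5 5 6 ∧
        (IsNontrivial c → (robinScheme D x₀ a c).HasAccuracyOrder D x₀ a β 7 5 5 6))) ∧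
    -- six is the maximum order for each pair of smooth coefficients in general position
    (∀ (a : ℝ × ℝ → ℝ) (β : ℝ → ℝ), D.IsCoefficients ∞ ∞ a β →
      2 * a (x₀, D.l₄) * β x₀ ≠ D.dy a (x₀, D.l₄) →
      IsGreatest {P : ℕ | ∃ S : SixPointScheme, S.HasAccuracyOrder D x₀ a β ∞ ∞ ∞ P} 6) ∧
    -- six is the maximum order available for all smooth coefficients
    IsGreatest {P : ℕ | ∀ (a : ℝ × ℝ → ℝ) (β : ℝ → ℝ), D.IsCoefficients ∞ ∞ a β →
      ∃ S : SixPointScheme, S.HasAccuracyOrder D x₀ a β ∞ ∞ ∞ P} 6 := by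
  refine ⟨fun a β hab => ⟨InterfaceDomain.exists_solvesSystem, fun c hc => ?_⟩,
    fun a β hab hne => ⟨InterfaceDomain.exists_hasAccuracyOrder_six hx₀ hreg hab, ?_⟩,
    fun a β hab => InterfaceDomain.exists_hasAccuracyOrder_six hx₀ hreg hab, fun P hP => ?_⟩
  · have h := InterfaceDomain.isConsistent_robinScheme hx₀ hreg hab hc
    exact ⟨h, fun hc' => ⟨InterfaceDomain.isNormalized_robinScheme hc', h⟩⟩
  · rintro P ⟨S, hS⟩
    exact InterfaceDomain.le_six_of_hasAccuracyOrder hx₀ hreg hab hne hS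
  -- The pair `a = β = 1` is in general position, since `2 ≠ 0`.
  · have hab : D.IsCoefficients ∞ ∞ (fun _ => 1) (fun _ => 1) :=
      ⟨fun _ _ => one_pos, contDiffOn_const, contDiffOn_const⟩
    obtain ⟨S, hS⟩ := hP _ _ hab
    refine InterfaceDomain.le_six_of_hasAccuracyOrder hx₀ hreg hab ?_ hS
    simp [InterfaceDomain.dy]
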